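/- Let $p,q\ge 0$ with $D=p+q\ge 2$, let $\eta=\mathrm{diag}(1,\dots,1,-1,\dots,-1)$ ($p$ plus signs, $q$ minus signs) be the metric of $\mathbb{R}^{p,q}$, let $j\ge 1$, and let $k\in\mathbb{R}^{p,q}$ with $k^2=k^nk_n\neq 0$. Put $\Theta^n_r=\delta^n_r-k_rk^n/k^2$. For $\omega=D-1$ let $\mathcal{B}r_j(\omega)$ be the Brauer algebra over $\mathbb{C}$ with its standard generators $\sigma_i,\kappa_i$ ($1\le i\le j-1$; $\kappa_i^2=\omega\kappa_i$) and Jucys–Murphy elements $$y_m=\sum_{l=1}^{m-1}\sigma_{m-1}\cdots\sigma_{l+1}(\sigma_l-\kappa_l)\sigma_{l+1}\cdots\sigma_{m-1},$$ and let $$E_{T_{\{[j];j\}}}=\frac{(y_2+1)\cdots(y_j+1)}{j!}\cdot\frac{(y_2+\omega-1)(y_3+\omega)\cdots(y_j+\omega+j-3)}{\omega(\omega+2)\cdots(\omega+2j-4)}$$ be its complete symmetrizer. Let $S_{(k)}$ be the representation of $\mathcal{B}r_j(D-1)$ on rank $j$ tensors over $\mathbb{R}^{p,q}$ (complexified) in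 which the unit acts as $\Theta^{\otimes j}$, $\sigma_r$ acts with components $\Theta^{n_r}_{i_{r+1}}\Theta^{n_{r+1}}_{i_r}\prod_{m\ne r,r+1}\Theta^{n_m}_{i_m}$, and $\kappa_r$ acts with components $\check\Theta^{n_rn_{r+1}}\hat\Theta_{i_ri_{r+1}}\prod_{m\neq r,r+1}\Theta^{n_m}_{i_m}$, where $\check\Theta^{nm}=\Theta^n_l\eta^{lm}$ and $\hat\Theta_{mn}=\Theta^l_m\eta_{ln}$. Then $\Theta_{\{[j];j\}}=S_{(k)}(E_{T_{\{[j];j\}}})$ is equal to (the complexification of) the $D$-dimensional Behrends–Fronsdal spin-$j$ projector $\Theta^{(j)}(k)$. That is, $\Theta_{\{[j];j\}}$ has real components $T^{n_1\dots n_j}_{r_1\dots r_j}$, and: 1. $T$ is idempotent and self-adjoint with respect to the form induced by $\eta$; it is symmetric under permutations of its upper indices and of its lower indices; it is transverse, i.e. the contraction of any lower index with $k^{r}$ and of any upper index with $k_{n}$ vanishes; and it is traceless, i.e. the contraction of any two lower indices with $\eta^{rr'}$ and of any two upper indices with $\eta_{nn'}$ vanishes. 2. The image of $T$ is the whole space of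 completely symmetric, transverse and traceless real tensors of rank $j$, and $T$ is the only operator with this image that has the properties in 1. 3. For all $x,u\in\mathbb{R}^{p,q}$, $$u_{n_1}\cdots u_{n_j}T^{n_1\dots n_j}_{r_1\dots r_j}x^{r_1}\cdots x^{r_j}=\sum_{A=0}^{\lfloor j/2\rfloor}a_A^{(j)}\bigl(\Theta^{(u)}_{(u)}\Theta^{(x)}_{(x)}\bigr)^A\bigl(\Theta^{(u)}_{(x)}\bigr)^{j-2A},$$ where $\Theta^{(u)}_{(x)}=x^ru_n\Theta^n_r$, $a^{(j)}_0=1$ and $$a_A^{(j)}=\frac{(-1/2)^A\,j!}{(j-2A)!\,A!\,(2j+D-5)(2j+D-7)\cdots(2j+D-2A-3)}\qquad(A\ge1).$$ -/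

import Mathlib

namespace BF

/-! ### The Brauer algebra -/

/-- Generators `σ_i`, `κ_i` (`i = 1, …, j - 1`; here `i` runs over `0, …, j - 2`). -/
inductive BrauerGen (j : ℕ) : Type
  | sigma (i : Fin (j - 1))
  | kappa (i : Fin (j - 1))

/-- The generator `σ_i` in the free algebra. -/
def freeSigma {j : ℕ} (i : Fin (j - 1)) : FreeAlgebra ℂ (BrauerGen j) :=
  FreeAlgebra.ι ℂ (BrauerGen.sigma i)

/-- The generator `κ_i` in the free algebra. -/
def freeKappa {j : ℕ} (i : Fin (j - 1)) : FreeAlgebra ℂ (BrauerGen j) :=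
  FreeAlgebra.ι ℂ (BrauerGen.kappa i)

/-- The defining relations of the Brauer algebra. -/
inductive BrauerRel (j : ℕ) (ω : ℂ) :
    FreeAlgebra ℂ (BrauerGen j) → FreeAlgebra ℂ (BrauerGen j) → Prop
  | sigma_sq (i : Fin (j - 1)) : BrauerRel j ω (freeSigma i * freeSigma i) 1
  | kappa_sq (i : Fin (j - 1)) : BrauerRel j ω (freeKappa i * freeKappa i) (ω • freeKappa i)
  | sigma_kappa (i : Fin (j - 1)) : BrauerRel j ω (freeSigma i * freeKappa i) (freeKappa i)
  | kappa_sigma (i : Fin (j - 1)) : BrauerRel j ω (freeKappa i * freeSigma i) (freeKappa i)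
  | sigma_comm (i l : Fin (j - 1)) (h : (i : ℕ) + 1 < l ∨ (l : ℕ) + 1 < i) :
      BrauerRel j ω (freeSigma i * freeSigma l) (freeSigma l * freeSigma i)
  | kappa_comm (i l : Fin (j - 1)) (h : (i : ℕ) + 1 < l ∨ (l : ℕ) + 1 < i) :
      BrauerRel j ω (freeKappa i * freeKappa l) (freeKappa l * freeKappa i)
  | sigma_kappa_comm (i l : Fin (j - 1)) (h : (i : ℕ) + 1 < l ∨ (l : ℕ) + 1 < i) :
      BrauerRel j ω (freeSigma i * freeKappa l) (freeKappa l * freeSigma i)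
  | braid (i l : Fin (j - 1)) (h : (i : ℕ) + 1 = l) :
      BrauerRel j ω (freeSigma i * freeSigma l * freeSigma i)
        (freeSigma l * freeSigma i * freeSigma l)
  | kappa_up (i l : Fin (j - 1)) (h : (i : ℕ) + 1 = l) :
      BrauerRel j ω (freeKappa i * freeKappa l * freeKappa i) (freeKappa i)
  | kappa_down (i l : Fin (j - 1)) (h : (i : ℕ) + 1 = l) :
      BrauerRel j ω (freeKappa l * freeKappa i * freeKappa l) (freeKappa l)
  | mixed_left (i l : Fin (j - 1)) (h : (i : ℕ) + 1 = l) :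
      BrauerRel j ω (freeSigma i * freeKappa l * freeKappa i) (freeSigma l * freeKappa i)
  | mixed_right (i l : Fin (j - 1)) (h : (i : ℕ) + 1 = l) :
      BrauerRel j ω (freeKappa l * freeKappa i * freeSigma l) (freeKappa l * freeSigma i)

/-- The Brauer algebra `Br_j(ω)` over `ℂ`. -/
abbrev BrauerAlgebra (j : ℕ) (ω : ℂ) : Type := RingQuot (BrauerRel j ω)

/-- `σ_i` for `i = 1, …, j - 1` (with the irrelevant value `0` for all other `i`). -/
noncomputable def sigma (j : ℕ) (ω : ℂ) (i : ℕ) : BrauerAlgebra j ω :=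
  if h : 1 ≤ i ∧ i < j then
    RingQuot.mkAlgHom ℂ (BrauerRel j ω) (freeSigma ⟨i - 1, by omega⟩)
  else 0

/-- `κ_i` for `i = 1, …, j - 1` (with the irrelevant value `0` for all other `i`). -/
noncomputable def kappa (j : ℕ) (ω : ℂ) (i : ℕ) : BrauerAlgebra j ω :=
  if h : 1 ≤ i ∧ i < j then
    RingQuot.mkAlgHom ℂ (BrauerRel j ω) (freeKappa ⟨i - 1, by omega⟩)
  else 0

/-- `sandwich j ω k d a = σ_{k+d} ⋯ σ_{k+1} a σ_{k+1} ⋯ σ_{k+d}`. -/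
noncomputable def sandwich (j : ℕ) (ω : ℂ) (k : ℕ) : ℕ → BrauerAlgebra j ω → BrauerAlgebra j ω
  | 0, a => a
  | d + 1, a => sigma j ω (k + d + 1) * sandwich j ω k d a * sigma j ω (k + d + 1)

/-- The Jucys–Murphy element
`y_m = ∑_{k=1}^{m-1} σ_{m-1} ⋯ σ_{k+1} (σ_k - κ_k) σ_{k+1} ⋯ σ_{m-1}`. -/
noncomputable def jucysMurphy (j : ℕ) (ω : ℂ) (m : ℕ) : BrauerAlgebra j ω :=
  ∑ k ∈ Finset.Ico 1 m, sandwich j ω k (m - 1 - k) (sigma j ω k - kappa j ω k)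

/-- The complete symmetrizer of `Br_j(ω)`:
`((y_2+1)⋯(y_j+1) / j!) * ((y_2+ω-1)⋯(y_j+ω+j-3) / (ω(ω+2)⋯(ω+2j-4)))`. -/
noncomputable def symmetrizer (j : ℕ) (ω : ℂ) : BrauerAlgebra j ω :=
  ((j.factorial : ℂ)⁻¹ • ((List.range' 2 (j - 1)).map fun m => jucysMurphy j ω m + 1).prod) *
    ((∏ m ∈ Finset.Icc 2 j, (ω + 2 * (m : ℂ) - 4))⁻¹ •
      ((List.range' 2 (j - 1)).map fun m =>
        jucysMurphy j ω m + algebraMap ℂ (BrauerAlgebra j ω) (ω + (m : ℂ) - 3)).prod)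

/-! ### Operators on tensors built from a triple of matrices

An operator on rank `n` tensors is given by its matrix of components, whose rows are the upper
multi-index and whose columns are the lower multi-index. -/

section Operators

set_option linter.unusedSectionVars false

variable {ι R : Type} [Fintype ι] [CommRing R] {n : ℕ}

/-- The tensor product `A_1 ⊗ ⋯ ⊗ A_n` of matrices. -/
def tens (A : Fin n → Matrix ι ι R) : Matrix (Fin n → ι) (Fin n → ι) R :=
  Matrix.of fun l i => ∏ m, A m (l m) (i m)

/-- The operator with components `∏_m θ^{l_m}_{i_{π(m)}}`; for `π` the transposition of two
neighbouring slots `r, r+1` this is `P_r^{(θ)}`. -/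
def permOp (θ : Matrix ι ι R) (π : Equiv.Perm (Fin n)) : Matrix (Fin n → ι) (Fin n → ι) R :=
  Matrix.of fun l i => ∏ m, θ (l m) (i (π m))

/-- The operator with components
`θcheck^{l_a l_b} θhat_{i_a i_b} ∏_{m ≠ a, b} θ^{l_m}_{i_m}`; for neighbouring slots `r, r+1`
this is `K_r^{(θ)}`. -/
def capOp (θ θhat θcheck : Matrix ι ι R) (a b : Fin n) : Matrix (Fin n → ι) (Fin n → ι) R :=
  Matrix.of fun l i => θcheck (l a) (l b) * θhat (i a) (i b) *
    ∏ m ∈ Finset.univ.filter (fun m => m ≠ a ∧ m ≠ b), θ (l m) (i m)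

/-- The relations on a triple `(θ, θhat, θcheck)` that are used, with `ω = Tr θ`. -/
structure IsTriple (θ θhat θcheck : Matrix ι ι R) (ω : R) : Prop where
  idem : θ * θ = θ
  check_hat : θcheck * θhat = θ
  mul_check : θ * θcheck = θcheck
  hat_mul : θhat * θ = θhat
  check_symm : θcheck.transpose = θcheck
  hat_symm : θhat.transpose = θhat
  trace_eq : θ.trace = ω

theorem tens_mul (A B : Fin n → Matrix ι ι R) : tens A * tens B = tens fun m => A m * B m := by
  ext l i
  simp only [tens, Matrix.mul_apply, Matrix.of_apply, ← Finset.prod_mul_distrib]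
  rw [Finset.prod_univ_sum, Fintype.piFinset_univ]


/-- Reindexing of multi-indices by a permutation of the slots. -/
def slotEquiv (π : Equiv.Perm (Fin n)) : (Fin n → ι) ≃ (Fin n → ι) :=
  Equiv.arrowCongr π.symm (Equiv.refl ι)

theorem slotEquiv_apply (π : Equiv.Perm (Fin n)) (i : Fin n → ι) (m : Fin n) :
    slotEquiv π i m = i (π m) := rfl

theorem permOp_one (θ : Matrix ι ι R) : permOp θ (1 : Equiv.Perm (Fin n)) = tens fun _ => θ := rfl

theorem permOp_eq (θ : Matrix ι ι R) (π : Equiv.Perm (Fin n)) :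
    permOp θ π = (permOp θ 1).submatrix id (slotEquiv π) := rfl

theorem permOp_one_submatrix (θ : Matrix ι ι R) (π : Equiv.Perm (Fin n)) :
    (permOp θ 1).submatrix (slotEquiv π) (slotEquiv π) = permOp θ 1 := by
  ext l i
  exact Equiv.prod_comp π fun m => θ (l m) (i m)

theorem permOp_one_mul_self {θ : Matrix ι ι R} (h : θ * θ = θ) :
    permOp θ (1 : Equiv.Perm (Fin n)) * permOp θ 1 = permOp θ 1 := by
  rw [permOp_one, tens_mul, h]

theorem permOp_mul {θ : Matrix ι ι R} (h : θ * θ = θ) (π τ : Equiv.Perm (Fin n)) :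
    permOp θ π * permOp θ τ = permOp θ (τ * π) := by
  have e : permOp θ τ = (permOp θ 1).submatrix (slotEquiv π) (slotEquiv (τ * π)) := by
    ext l i
    simp only [permOp, Matrix.of_apply, Matrix.submatrix_apply, slotEquiv_apply]
    exact (Equiv.prod_comp π fun m => θ (l m) (i (τ m))).symm
  rw [e, permOp_eq θ π, Matrix.submatrix_mul_equiv, permOp_one_mul_self h, ← permOp_eq]

theorem capOp_submatrix (θ θhat θcheck : Matrix ι ι R) (π : Equiv.Perm (Fin n)) (a b : Fin n) :
    (capOp θ θhat θcheck a b).submatrix (slotEquiv π) (slotEquiv π) =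
      capOp θ θhat θcheck (π a) (π b) := by
  ext l i
  simp only [capOp, Matrix.of_apply, Matrix.submatrix_apply, slotEquiv_apply]
  congr 1
  simp only [Finset.prod_filter]
  rw [← Equiv.prod_comp π (fun m => if m ≠ π a ∧ m ≠ π b then θ (l m) (i m) else 1)]
  simp

/-- The pure tensors whose sum is `capOp`. -/
def capTerm (θ θhat θcheck : Matrix ι ι R) (a b : Fin n) (s t : ι) (m : Fin n) : Matrix ι ι R :=
  if m = a then Matrix.vecMulVec (fun u => θ u s) (fun v => θ t v)
  else if m = b then Matrix.vecMulVec (fun u => θcheck s u) (fun v => θhat t v)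
  else θ

theorem prod_split {a b : Fin n} (hab : a ≠ b) (f : Fin n → R) :
    ∏ m, f m = f a * f b * ∏ m ∈ Finset.univ.filter (fun m => m ≠ a ∧ m ≠ b), f m := by
  rw [← Finset.mul_prod_erase Finset.univ f (Finset.mem_univ a),
    ← Finset.mul_prod_erase (Finset.univ.erase a) f (a := b) (by simp [hab.symm]), ← mul_assoc]
  congr 1
  apply Finset.prod_congr _ (fun _ _ => rfl)
  ext m
  simp [and_comm]

variable {θ θhat θcheck : Matrix ι ι R} {ω : R}

theorem capOp_eq_sum (H : IsTriple θ θhat θcheck ω) {a b : Fin n} (hab : a ≠ b) :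
    capOp θ θhat θcheck a b = ∑ s, ∑ t, tens (capTerm θ θhat θcheck a b s t) := by
  ext l i
  have h1 : ∀ u v, θcheck u v = ∑ s, θ u s * θcheck s v := fun u v => by
    rw [← Matrix.mul_apply, H.mul_check]
  have h2 : ∀ u v, θhat u v = ∑ t, θ t u * θhat t v := fun u v => by
    have : θhat u v = θhat v u := congrFun (congrFun H.hat_symm.symm u) v
    rw [this]
    conv_lhs => rw [← H.hat_mul, Matrix.mul_apply]
    refine Finset.sum_congr rfl fun t _ => ?_
    have : θhat v t = θhat t v := congrFun (congrFun H.hat_symm.symm v) t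
    rw [this, mul_comm]
  simp only [Matrix.sum_apply, tens, Matrix.of_apply, capOp]
  rw [h1, h2, Finset.sum_mul_sum, Finset.sum_mul]
  refine Finset.sum_congr rfl fun s _ => ?_
  rw [Finset.sum_mul]
  refine Finset.sum_congr rfl fun t _ => ?_
  rw [prod_split hab]
  have : ∏ m ∈ Finset.univ.filter (fun m => m ≠ a ∧ m ≠ b),
      capTerm θ θhat θcheck a b s t m (l m) (i m) =
      ∏ m ∈ Finset.univ.filter (fun m => m ≠ a ∧ m ≠ b), θ (l m) (i m) := by
    refine Finset.prod_congr rfl fun m hm => ?_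
    simp only [Finset.mem_filter] at hm
    simp [capTerm, hm.2.1, hm.2.2]
  rw [this]
  simp only [capTerm, if_true, if_neg hab.symm, Matrix.vecMulVec_apply]
  ring

theorem IsTriple.check_mul_apply (H : IsTriple θ θhat θcheck ω) (u v : ι) :
    ∑ s, θcheck u s * θ v s = θcheck u v := by
  have h := congrFun (congrFun H.mul_check v) u
  rw [Matrix.mul_apply] at h
  have hs : ∀ x y, θcheck x y = θcheck y x := fun x y => congrFun (congrFun H.check_symm.symm x) y
  rw [hs u v, ← h]
  exact Finset.sum_congr rfl fun s _ => by rw [hs u s, mul_comm]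

theorem capTerm_mul (H : IsTriple θ θhat θcheck ω) (a b : Fin n) (s t : ι) (m : Fin n) :
    capTerm θ θhat θcheck a b s t m * θ = capTerm θ θhat θcheck a b s t m := by
  unfold capTerm
  split_ifs
  · rw [Matrix.vecMulVec_mul]
    congr 1
    ext v
    exact congrFun (congrFun H.idem t) v
  · rw [Matrix.vecMulVec_mul]
    congr 1
    ext v
    exact congrFun (congrFun H.hat_mul t) v
  · exact H.idem

theorem mul_capTerm (H : IsTriple θ θhat θcheck ω) (a b : Fin n) (s t : ι) (m : Fin n) :
    θ * capTerm θ θhat θcheck a b s t m = capTerm θ θhat θcheck a b s t m := by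
  unfold capTerm
  split_ifs
  · rw [Matrix.mul_vecMulVec]
    congr 1
    ext u
    exact congrFun (congrFun H.idem u) s
  · rw [Matrix.mul_vecMulVec]
    congr 1
    ext u
    rw [← H.check_mul_apply s u]
    exact Finset.sum_congr rfl fun v _ => mul_comm _ _
  · exact H.idem

theorem capOp_mul_one (H : IsTriple θ θhat θcheck ω) {a b : Fin n} (hab : a ≠ b) :
    capOp θ θhat θcheck a b * permOp θ 1 = capOp θ θhat θcheck a b := by
  simp only [capOp_eq_sum H hab, permOp_one, Finset.sum_mul, tens_mul, capTerm_mul H]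

theorem one_mul_capOp (H : IsTriple θ θhat θcheck ω) {a b : Fin n} (hab : a ≠ b) :
    permOp θ 1 * capOp θ θhat θcheck a b = capOp θ θhat θcheck a b := by
  simp only [capOp_eq_sum H hab, permOp_one, Finset.mul_sum, tens_mul, mul_capTerm H]

theorem permOp_mul_capOp' (H : IsTriple θ θhat θcheck ω) (π : Equiv.Perm (Fin n)) {a b : Fin n}
    (hab : a ≠ b) :
    permOp θ π * capOp θ θhat θcheck (π a) (π b) =
      (capOp θ θhat θcheck a b).submatrix id (slotEquiv π) := by
  rw [← capOp_submatrix, permOp_eq, Matrix.submatrix_mul_equiv, one_mul_capOp H hab]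

theorem permOp_mul_capOp (H : IsTriple θ θhat θcheck ω) (π : Equiv.Perm (Fin n)) {a b : Fin n}
    (hab : a ≠ b) :
    permOp θ π * capOp θ θhat θcheck (π a) (π b) = capOp θ θhat θcheck a b * permOp θ π := by
  have h := Matrix.submatrix_mul_equiv (capOp θ θhat θcheck a b) (permOp θ 1) id
    (Equiv.refl _) (slotEquiv π)
  rw [permOp_mul_capOp' H π hab, permOp_eq θ π]
  conv_lhs => rw [← capOp_mul_one H hab]
  exact h.symm

theorem capOp_comm (H : IsTriple θ θhat θcheck ω) (a b : Fin n) :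
    capOp θ θhat θcheck a b = capOp θ θhat θcheck b a := by
  ext l i
  have h1 : θhat (i a) (i b) = θhat (i b) (i a) := congrFun (congrFun H.hat_symm.symm _) _
  have h2 : θcheck (l a) (l b) = θcheck (l b) (l a) := congrFun (congrFun H.check_symm.symm _) _
  simp only [capOp, Matrix.of_apply, h1, h2, and_comm]

theorem swap_mul_capOp (H : IsTriple θ θhat θcheck ω) {a b : Fin n} (hab : a ≠ b) :
    permOp θ (Equiv.swap a b) * capOp θ θhat θcheck a b = capOp θ θhat θcheck a b := by
  have h := permOp_mul_capOp' H (Equiv.swap a b) hab.symm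
  rw [Equiv.swap_apply_right, Equiv.swap_apply_left] at h
  rw [h, capOp_comm H b a]
  ext l i
  have h1 : θhat (i b) (i a) = θhat (i a) (i b) := congrFun (congrFun H.hat_symm.symm _) _
  simp only [capOp, Matrix.submatrix_apply, Matrix.of_apply, slotEquiv_apply, id,
    Equiv.swap_apply_left, Equiv.swap_apply_right, h1]
  congr 1
  refine Finset.prod_congr rfl fun m hm => ?_
  simp only [Finset.mem_filter] at hm
  rw [Equiv.swap_apply_of_ne_of_ne hm.2.1 hm.2.2]

theorem capOp_mul_swap (H : IsTriple θ θhat θcheck ω) {a b : Fin n} (hab : a ≠ b) :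
    capOp θ θhat θcheck a b * permOp θ (Equiv.swap a b) = capOp θ θhat θcheck a b := by
  rw [← permOp_mul_capOp H _ hab, Equiv.swap_apply_left, Equiv.swap_apply_right,
    Equiv.swap_comm, swap_mul_capOp H hab.symm, capOp_comm H]

theorem capOp_mul_comm (H : IsTriple θ θhat θcheck ω) {a b c d : Fin n} (hab : a ≠ b)
    (hcd : c ≠ d) (hac : a ≠ c) (had : a ≠ d) (hbc : b ≠ c) (hbd : b ≠ d) :
    capOp θ θhat θcheck a b * capOp θ θhat θcheck c d =
      capOp θ θhat θcheck c d * capOp θ θhat θcheck a b := by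
  have key : ∀ s t s' t' : ι,
      (tens fun m => capTerm θ θhat θcheck a b s t m * capTerm θ θhat θcheck c d s' t' m) =
      tens fun m => capTerm θ θhat θcheck c d s' t' m * capTerm θ θhat θcheck a b s t m := by
    intro s t s' t'
    congr 1
    ext1 m
    by_cases hm : m = a ∨ m = b
    · have : capTerm θ θhat θcheck c d s' t' m = θ := by
        unfold capTerm
        rw [if_neg, if_neg]
        · rintro rfl; rcases hm with h | h
          · exact had h.symm
          · exact hbd h.symm
        · rintro rfl; rcases hm with h | h
          · exact hac h.symm
          · exact hbc h.symm
      rw [this, capTerm_mul H, mul_capTerm H]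
    · have : capTerm θ θhat θcheck a b s t m = θ := by
        unfold capTerm
        rw [if_neg (fun h => hm (Or.inl h)), if_neg (fun h => hm (Or.inr h))]
      rw [this, capTerm_mul H, mul_capTerm H]
  have : Commute (capOp θ θhat θcheck a b) (capOp θ θhat θcheck c d) := by
    rw [capOp_eq_sum H hab, capOp_eq_sum H hcd]
    refine Commute.sum_left _ _ _ fun s _ => Commute.sum_left _ _ _ fun t _ =>
      Commute.sum_right _ _ _ fun s' _ => Commute.sum_right _ _ _ fun t' _ => ?_
    rw [Commute, SemiconjBy, tens_mul, tens_mul, key]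
  exact this.eq

theorem sum_sum_mul {M : Type} [NonUnitalNonAssocSemiring M] (F G : ι → ι → M) :
    (∑ s, ∑ t, F s t) * (∑ s, ∑ t, G s t) = ∑ s, ∑ t, ∑ s', ∑ t', F s t * G s' t' := by
  simp_rw [Finset.sum_mul, Finset.mul_sum]

theorem IsTriple.hat_check_apply (H : IsTriple θ θhat θcheck ω) (t s : ι) :
    ∑ v, θhat t v * θcheck s v = θ s t := by
  rw [← H.check_hat, Matrix.mul_apply]
  refine Finset.sum_congr rfl fun v _ => ?_
  have : θhat v t = θhat t v := congrFun (congrFun H.hat_symm.symm v) t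
  rw [this, mul_comm]

theorem capOp_mul_self (H : IsTriple θ θhat θcheck ω) {a b : Fin n} (hab : a ≠ b) :
    capOp θ θhat θcheck a b * capOp θ θhat θcheck a b = ω • capOp θ θhat θcheck a b := by
  have key : ∀ s t s' t' : ι,
      tens (capTerm θ θhat θcheck a b s t) * tens (capTerm θ θhat θcheck a b s' t') =
        (θ t s' * θ s' t) • tens (capTerm θ θhat θcheck a b s t') := by
    intro s t s' t'
    have h1 : ∑ v, θ t v * θ v s' = θ t s' := congrFun (congrFun H.idem t) s'
    have h2 := H.hat_check_apply t s'
    rw [tens_mul]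
    ext l i
    simp only [tens, Matrix.of_apply, Matrix.smul_apply, smul_eq_mul]
    rw [prod_split hab, prod_split hab]
    have h3 : ∏ m ∈ Finset.univ.filter (fun m => m ≠ a ∧ m ≠ b),
        (capTerm θ θhat θcheck a b s t m * capTerm θ θhat θcheck a b s' t' m) (l m) (i m) =
        ∏ m ∈ Finset.univ.filter (fun m => m ≠ a ∧ m ≠ b),
          capTerm θ θhat θcheck a b s t' m (l m) (i m) := by
      refine Finset.prod_congr rfl fun m hm => ?_
      simp only [Finset.mem_filter] at hm
      simp only [capTerm, if_neg hm.2.1, if_neg hm.2.2, H.idem]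
    rw [h3]
    simp only [capTerm, if_true, if_neg hab.symm, Matrix.vecMulVec_mul_vecMulVec,
      Matrix.vecMulVec_apply, dotProduct, Pi.smul_apply, h1, h2, smul_eq_mul]
    ring
  rw [capOp_eq_sum H hab, sum_sum_mul]
  simp only [key]
  have hω : ω = ∑ t, ∑ s', θ t s' * θ s' t := by
    rw [← H.trace_eq]
    conv_lhs => rw [← H.idem]
    rfl
  rw [Finset.smul_sum]
  refine Finset.sum_congr rfl fun s _ => ?_
  rw [hω]
  simp only [← Finset.smul_sum, ← Finset.sum_smul]

theorem capOp_mul_capOp (H : IsTriple θ θhat θcheck ω) {a b c : Fin n} (hab : a ≠ b)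
    (hbc : b ≠ c) (hac : a ≠ c) :
    capOp θ θhat θcheck a b * capOp θ θhat θcheck b c =
      permOp θ (Equiv.swap a c) * capOp θ θhat θcheck b c := by
  have hR := permOp_mul_capOp' H (Equiv.swap a c) hab.symm
  rw [Equiv.swap_apply_of_ne_of_ne hab.symm hbc, Equiv.swap_apply_left] at hR
  rw [hR, capOp_eq_sum H hab, capOp_eq_sum H hbc, sum_sum_mul]
  ext l i
  simp only [tens_mul, Matrix.sum_apply]
  have hc : c ∈ Finset.univ.filter (fun m => m ≠ a ∧ m ≠ b) := by
    simp [hac.symm, hbc.symm]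
  set r := ∏ m ∈ (Finset.univ.filter (fun m => m ≠ a ∧ m ≠ b)).erase c, θ (l m) (i m) with hr
  have key : ∀ s t s' t' : ι,
      tens (fun m => capTerm θ θhat θcheck a b s t m * capTerm θ θhat θcheck b c s' t' m) l i =
        (θ (l a) s * θcheck s (l b)) * ((θ t (i a) * (θhat t s' * θcheck s' (l c))) *
          (θ t' (i b) * θhat t' (i c))) * r := by
    intro s t s' t'
    simp only [tens, Matrix.of_apply]
    rw [prod_split hab, ← Finset.mul_prod_erase _ _ hc]
    have h3 : ∏ m ∈ (Finset.univ.filter (fun m => m ≠ a ∧ m ≠ b)).erase c,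
        (capTerm θ θhat θcheck a b s t m * capTerm θ θhat θcheck b c s' t' m) (l m) (i m) = r := by
      refine Finset.prod_congr rfl fun m hm => ?_
      simp only [Finset.mem_erase, Finset.mem_filter] at hm
      simp only [capTerm, if_neg hm.1, if_neg hm.2.2.1, if_neg hm.2.2.2, H.idem]
    have ha' : capTerm θ θhat θcheck b c s' t' a = θ := by simp [capTerm, hab, hac]
    have hc' : capTerm θ θhat θcheck a b s t c = θ := by simp [capTerm, hac.symm, hbc.symm]
    have h4 : ∑ v, θhat t v * θ v s' = θhat t s' := congrFun (congrFun H.hat_mul t) s'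
    rw [h3, ha', hc', capTerm_mul H, mul_capTerm H]
    simp only [capTerm, if_true, if_neg hab.symm, if_neg hbc.symm, Matrix.vecMulVec_mul_vecMulVec,
      Matrix.vecMulVec_apply, dotProduct, h4, Pi.smul_apply, smul_eq_mul]
    ring
  simp only [key, ← Finset.mul_sum, ← Finset.sum_mul]
  have e1 : ∑ s, θ (l a) s * θcheck s (l b) = θcheck (l b) (l a) := by
    rw [← Matrix.mul_apply, H.mul_check]
    exact congrFun (congrFun H.check_symm.symm _) _
  have hs : ∀ x y, θhat x y = θhat y x := fun x y => congrFun (congrFun H.hat_symm.symm x) y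
  have e2 : ∑ t', θ t' (i b) * θhat t' (i c) = θhat (i b) (i c) := by
    have h := congrFun (congrFun H.hat_mul (i c)) (i b)
    rw [Matrix.mul_apply] at h
    rw [hs (i b), ← h]
    exact Finset.sum_congr rfl fun v _ => by rw [hs (i c) v, mul_comm]
  have e3 : ∑ t, θ t (i a) * ∑ s', θhat t s' * θcheck s' (l c) = θ (l c) (i a) := by
    have h5 : ∀ t, ∑ s', θhat t s' * θcheck s' (l c) = θ (l c) t := fun t => by
      rw [← H.hat_check_apply t (l c)]
      refine Finset.sum_congr rfl fun v _ => ?_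
      rw [show θcheck v (l c) = θcheck (l c) v from congrFun (congrFun H.check_symm.symm _) _]
    simp only [h5]
    rw [← congrFun (congrFun H.idem (l c)) (i a), Matrix.mul_apply]
    exact Finset.sum_congr rfl fun v _ => mul_comm _ _
  rw [e1, e2, e3]
  simp only [capOp, Matrix.submatrix_apply, Matrix.of_apply, slotEquiv_apply, id,
    Equiv.swap_apply_left, Equiv.swap_apply_of_ne_of_ne hab.symm hbc]
  have hc2 : c ∈ Finset.univ.filter (fun m => m ≠ b ∧ m ≠ a) := by
    simp [hac.symm, hbc.symm]
  rw [← Finset.mul_prod_erase _ _ hc2, Equiv.swap_apply_right]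
  have h6 : ∏ m ∈ (Finset.univ.filter (fun m => m ≠ b ∧ m ≠ a)).erase c,
      θ (l m) (i (Equiv.swap a c m)) = r := by
    rw [hr]
    refine Finset.prod_congr (by ext m; simp [and_comm]) fun m hm => ?_
    simp only [Finset.mem_erase, Finset.mem_filter] at hm
    rw [Equiv.swap_apply_of_ne_of_ne (by tauto) hm.1]
  rw [h6]
  ring

end Operators

/-! ### The representation of the Brauer algebra attached to a triple -/

/-- The slot `r` of the pair of neighbouring slots `r, r + 1`. -/
def lo {j : ℕ} (i : Fin (j - 1)) : Fin j := ⟨i, by omega⟩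

/-- The slot `r + 1` of the pair of neighbouring slots `r, r + 1`. -/
def hi {j : ℕ} (i : Fin (j - 1)) : Fin j := ⟨i + 1, by omega⟩

theorem lo_ne_hi {j : ℕ} (i : Fin (j - 1)) : lo i ≠ hi i := by
  simp [lo, hi]

section Representation

variable {ι : Type} [Fintype ι] [DecidableEq ι] {j : ℕ}
  {θ θhat θcheck : Matrix ι ι ℂ} {ω : ℂ}

/-- `P_r^{(θ)}`. -/
def sigmaOp (θ : Matrix ι ι ℂ) (i : Fin (j - 1)) : Matrix (Fin j → ι) (Fin j → ι) ℂ :=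
  permOp θ (Equiv.swap (lo i) (hi i))

/-- `K_r^{(θ)}`. -/
def kappaOp (θ θhat θcheck : Matrix ι ι ℂ) (i : Fin (j - 1)) :
    Matrix (Fin j → ι) (Fin j → ι) ℂ :=
  capOp θ θhat θcheck (lo i) (hi i)

/-- A unital auxiliary homomorphism: `σ_r ↦ P_r + (1 - θ^{⊗ j})` and `κ_r ↦ K_r`. -/
noncomputable def genMap (θ θhat θcheck : Matrix ι ι ℂ) :
    BrauerGen j → Matrix (Fin j → ι) (Fin j → ι) ℂ
  | .sigma i => sigmaOp θ i + (1 - permOp θ 1)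
  | .kappa i => kappaOp θ θhat θcheck i

theorem corner_mul {M : Type} [Ring M] {Q A B : M} (hQ : Q * Q = Q) (h1 : A * Q = A)
    (h2 : Q * B = B) : (A + (1 - Q)) * (B + (1 - Q)) = A * B + (1 - Q) := by
  simp only [add_mul, mul_add, mul_sub, sub_mul, mul_one, one_mul, h1, h2, hQ]
  abel

theorem corner_mul_left {M : Type} [Ring M] {Q A B : M} (h2 : Q * B = B) :
    (A + (1 - Q)) * B = A * B := by
  simp only [add_mul, sub_mul, one_mul, h2]
  abel

theorem corner_mul_right {M : Type} [Ring M] {Q A B : M} (h2 : B * Q = B) :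
    B * (A + (1 - Q)) = B * A := by
  simp only [mul_add, mul_sub, mul_one, h2]
  abel

theorem swap_braid {α : Type} [DecidableEq α] {a b c : α} (hab : a ≠ b) (hac : a ≠ c)
    (hbc : b ≠ c) :
    Equiv.swap a b * Equiv.swap b c * Equiv.swap a b =
      Equiv.swap b c * Equiv.swap a b * Equiv.swap b c := by
  ext x
  simp only [Equiv.Perm.mul_apply, Equiv.swap_apply_def]
  grind

theorem swap_cycle {α : Type} [DecidableEq α] {a b c : α} (hab : a ≠ b) (hac : a ≠ c)
    (hbc : b ≠ c) :
    Equiv.swap c a * Equiv.swap a b = Equiv.swap a b * Equiv.swap b c := by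
  ext x
  simp only [Equiv.Perm.mul_apply, Equiv.swap_apply_def]
  grind

theorem swap_cycle' {α : Type} [DecidableEq α] {a b c : α} (hab : a ≠ b) (hac : a ≠ c)
    (hbc : b ≠ c) :
    Equiv.swap b c * Equiv.swap c a = Equiv.swap a b * Equiv.swap b c := by
  ext x
  simp only [Equiv.Perm.mul_apply, Equiv.swap_apply_def]
  grind

theorem genMap_rel (H : IsTriple θ θhat θcheck ω) ⦃x y : FreeAlgebra ℂ (BrauerGen j)⦄
    (h : BrauerRel j ω x y) :
    FreeAlgebra.lift ℂ (genMap θ θhat θcheck) x = FreeAlgebra.lift ℂ (genMap θ θhat θcheck) y := by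
  have hQ := permOp_one_mul_self (n := j) H.idem
  have hs : ∀ i : Fin (j - 1), FreeAlgebra.lift ℂ (genMap θ θhat θcheck) (freeSigma i) =
      permOp θ (Equiv.swap (lo i) (hi i)) + (1 - permOp θ 1) := fun i => by
    simp [freeSigma, genMap, sigmaOp]
  have hk : ∀ i : Fin (j - 1), FreeAlgebra.lift ℂ (genMap θ θhat θcheck) (freeKappa i) =
      capOp θ θhat θcheck (lo i) (hi i) := fun i => by
    simp [freeKappa, genMap, kappaOp]
  have pQ : ∀ π : Equiv.Perm (Fin j), permOp θ π * permOp θ 1 = permOp θ π := fun π => by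
    rw [permOp_mul H.idem, one_mul]
  have Qp : ∀ π : Equiv.Perm (Fin j), permOp θ 1 * permOp θ π = permOp θ π := fun π => by
    rw [permOp_mul H.idem, mul_one]
  have Qk : ∀ i : Fin (j - 1), permOp θ 1 * capOp θ θhat θcheck (lo i) (hi i) = _ :=
    fun i => one_mul_capOp H (lo_ne_hi i)
  have kQ : ∀ i : Fin (j - 1), capOp θ θhat θcheck (lo i) (hi i) * permOp θ 1 = _ :=
    fun i => capOp_mul_one H (lo_ne_hi i)
  have ne : ∀ a b : Fin j, (a : ℕ) ≠ b → a ≠ b := fun a b h h' => h (congrArg _ h')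
  cases h with
  | sigma_sq i =>
    simp only [map_mul, map_one, hs]
    rw [corner_mul hQ (pQ _) (Qp _), permOp_mul H.idem, Equiv.swap_mul_self, add_sub_cancel]
  | kappa_sq i => simp only [map_mul, map_smul, hk, capOp_mul_self H (lo_ne_hi i)]
  | sigma_kappa i =>
    simp only [map_mul, hs, hk]
    rw [corner_mul_left (Qk i), swap_mul_capOp H (lo_ne_hi i)]
  | kappa_sigma i =>
    simp only [map_mul, hs, hk]
    rw [corner_mul_right (kQ i), capOp_mul_swap H (lo_ne_hi i)]
  | sigma_comm i l h =>
    simp only [map_mul, hs]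
    rw [corner_mul hQ (pQ _) (Qp _), corner_mul hQ (pQ _) (Qp _), permOp_mul H.idem,
      permOp_mul H.idem]
    congr 2
    ext x
    simp only [Equiv.Perm.mul_apply, Equiv.swap_apply_def, lo, hi]
    grind
  | kappa_comm i l h =>
    simp only [map_mul, hk]
    apply capOp_mul_comm H (lo_ne_hi i) (lo_ne_hi l) <;> apply ne <;> simp only [lo, hi] <;> omega
  | sigma_kappa_comm i l h =>
    simp only [map_mul, hs, hk]
    rw [corner_mul_left (Qk l), corner_mul_right (kQ l), ← permOp_mul_capOp H _ (lo_ne_hi l),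
      Equiv.swap_apply_of_ne_of_ne, Equiv.swap_apply_of_ne_of_ne] <;>
      apply ne <;> simp only [lo, hi] <;> omega
  | braid i l h =>
    have hl : lo l = hi i := Fin.ext h.symm
    have h1 : lo i ≠ hi i := lo_ne_hi i
    have h2 : hi i ≠ hi l := hl ▸ lo_ne_hi l
    have h3 : lo i ≠ hi l := ne _ _ (by simp only [lo, hi]; omega)
    simp only [map_mul, hs]
    rw [corner_mul hQ (pQ _) (Qp _), corner_mul hQ (pQ _) (Qp _), permOp_mul H.idem,
      permOp_mul H.idem, corner_mul hQ (pQ _) (Qp _), corner_mul hQ (pQ _) (Qp _),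
      permOp_mul H.idem, permOp_mul H.idem, hl, ← mul_assoc, ← mul_assoc, swap_braid h1 h3 h2]
  | kappa_up i l h =>
    have hl : lo l = hi i := Fin.ext h.symm
    have h1 : lo i ≠ hi i := lo_ne_hi i
    have h2 : hi i ≠ hi l := hl ▸ lo_ne_hi l
    have h3 : lo i ≠ hi l := ne _ _ (by simp only [lo, hi]; omega)
    simp only [map_mul, hk, hl]
    rw [capOp_mul_capOp H h1 h2 h3, mul_assoc, capOp_comm H (hi i) (hi l),
      capOp_comm H (lo i) (hi i), capOp_mul_capOp H h2.symm h1.symm h3.symm, ← mul_assoc,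
      permOp_mul H.idem, Equiv.swap_comm (hi l) (lo i), Equiv.swap_mul_self,
      one_mul_capOp H h1.symm]
  | kappa_down i l h =>
    have hl : lo l = hi i := Fin.ext h.symm
    have h1 : lo i ≠ hi i := lo_ne_hi i
    have h2 : hi i ≠ hi l := hl ▸ lo_ne_hi l
    have h3 : lo i ≠ hi l := ne _ _ (by simp only [lo, hi]; omega)
    simp only [map_mul, hk, hl]
    rw [capOp_comm H (hi i) (hi l), capOp_comm H (lo i) (hi i),
      capOp_mul_capOp H h2.symm h1.symm h3.symm, mul_assoc, capOp_comm H (hi l) (hi i),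
      capOp_comm H (hi i) (lo i), capOp_mul_capOp H h1 h2 h3, ← mul_assoc,
      permOp_mul H.idem, Equiv.swap_comm (hi l) (lo i), Equiv.swap_mul_self,
      one_mul_capOp H h2]
  | mixed_left i l h =>
    have hl : lo l = hi i := Fin.ext h.symm
    have h1 : lo i ≠ hi i := lo_ne_hi i
    have h2 : hi i ≠ hi l := hl ▸ lo_ne_hi l
    have h3 : lo i ≠ hi l := ne _ _ (by simp only [lo, hi]; omega)
    have Qk' := Qk l
    rw [hl] at Qk'
    simp only [map_mul, hs, hk, hl]
    rw [corner_mul_left Qk', corner_mul_left (Qk i), mul_assoc, capOp_comm H (hi i) (hi l)]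
    conv_rhs => rw [← swap_mul_capOp H h1]
    rw [capOp_comm H (lo i) (hi i), capOp_mul_capOp H h2.symm h1.symm h3.symm, ← mul_assoc,
      ← mul_assoc, permOp_mul H.idem, permOp_mul H.idem, swap_cycle h1 h3 h2]
  | mixed_right i l h =>
    have hl : lo l = hi i := Fin.ext h.symm
    have h1 : lo i ≠ hi i := lo_ne_hi i
    have h2 : hi i ≠ hi l := hl ▸ lo_ne_hi l
    have h3 : lo i ≠ hi l := ne _ _ (by simp only [lo, hi]; omega)
    have kQ' := kQ l
    rw [hl] at kQ'
    have e := permOp_mul_capOp H (Equiv.swap (hi l) (lo i)) (a := hi l) (b := hi i) h2.symm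
    rw [Equiv.swap_apply_left, Equiv.swap_apply_of_ne_of_ne h2 h1.symm] at e
    simp only [map_mul, hs, hk, hl]
    rw [corner_mul_right kQ', mul_assoc, corner_mul_right (kQ i), ← mul_assoc]
    conv_rhs => rw [← capOp_mul_swap H h2]
    rw [capOp_comm H (hi i) (hi l), capOp_comm H (lo i) (hi i),
      capOp_mul_capOp H h2.symm h1.symm h3.symm, capOp_comm H (hi i) (lo i), e, mul_assoc,
      mul_assoc, permOp_mul H.idem, permOp_mul H.idem, swap_cycle' h1 h3 h2]

/-- The unital homomorphism with values `genMap` on the generators. -/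
noncomputable def unitalHom (H : IsTriple θ θhat θcheck ω) :
    BrauerAlgebra j ω →ₐ[ℂ] Matrix (Fin j → ι) (Fin j → ι) ℂ :=
  RingQuot.liftAlgHom ℂ ⟨FreeAlgebra.lift ℂ (genMap θ θhat θcheck), genMap_rel H⟩

theorem unitalHom_mk (H : IsTriple θ θhat θcheck ω) (x : FreeAlgebra ℂ (BrauerGen j)) :
    unitalHom H (RingQuot.mkAlgHom ℂ (BrauerRel j ω) x) =
      FreeAlgebra.lift ℂ (genMap θ θhat θcheck) x :=
  RingQuot.liftAlgHom_mkAlgHom_apply _ _ _ _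

theorem unitalHom_comm (H : IsTriple θ θhat θcheck ω) (a : BrauerAlgebra j ω) :
    permOp θ 1 * unitalHom H a = unitalHom H a * permOp θ 1 := by
  obtain ⟨x, rfl⟩ := RingQuot.mkAlgHom_surjective ℂ (BrauerRel j ω) a
  rw [unitalHom_mk]
  induction x using FreeAlgebra.induction with
  | grade0 r => rw [AlgHom.commutes, Algebra.commutes]
  | grade1 g =>
    rw [FreeAlgebra.lift_ι_apply]
    cases g with
    | sigma i =>
      have h1 := permOp_mul H.idem (1 : Equiv.Perm (Fin j)) (Equiv.swap (lo i) (hi i))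
      have h2 := permOp_mul H.idem (Equiv.swap (lo i) (hi i)) (1 : Equiv.Perm (Fin j))
      rw [mul_one] at h1
      rw [one_mul] at h2
      simp only [genMap, sigmaOp, mul_add, add_mul, mul_sub, sub_mul, mul_one, one_mul, h1, h2]
    | kappa i =>
      simp only [genMap, kappaOp, one_mul_capOp H (lo_ne_hi i), capOp_mul_one H (lo_ne_hi i)]
  | mul a b ha hb => rw [map_mul, ← mul_assoc, ha, mul_assoc, hb, mul_assoc]
  | add a b ha hb => rw [map_add, mul_add, add_mul, ha, hb]

/-- The representation `S_θ` of the Brauer algebra on rank `j` tensors. Its values on the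
generators are `S_θ(σ_r) = P_r^{(θ)}` and `S_θ(κ_r) = K_r^{(θ)}`. Since
`P_r^{(θ)} P_r^{(θ)} = θ^{⊗ j}`, the unit is sent to the projector `θ^{⊗ j}`. -/
noncomputable def tensorRep (H : IsTriple θ θhat θcheck ω) :
    BrauerAlgebra j ω →ₙₐ[ℂ] Matrix (Fin j → ι) (Fin j → ι) ℂ where
  toFun a := permOp θ 1 * unitalHom H a
  map_smul' c a := by simp
  map_zero' := by simp
  map_add' a b := by simp [mul_add]
  map_mul' a b := by
    rw [map_mul, mul_assoc, ← mul_assoc (unitalHom H a), ← unitalHom_comm H a, ← mul_assoc,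
      ← mul_assoc, ← mul_assoc, permOp_one_mul_self H.idem]

theorem tensorRep_one (H : IsTriple θ θhat θcheck ω) :
    tensorRep H (1 : BrauerAlgebra j ω) = tens fun _ => θ := by
  change permOp θ 1 * unitalHom H 1 = _
  rw [map_one, mul_one, permOp_one]

theorem tensorRep_sigma (H : IsTriple θ θhat θcheck ω) (i : Fin (j - 1)) :
    tensorRep H (sigma j ω (i + 1)) = sigmaOp θ i := by
  change permOp θ 1 * unitalHom H _ = _
  have h : 1 ≤ (i : ℕ) + 1 ∧ (i : ℕ) + 1 < j := by omega
  rw [sigma, dif_pos h, unitalHom_mk, freeSigma, FreeAlgebra.lift_ι_apply]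
  change permOp θ 1 * (permOp θ (Equiv.swap (lo i) (hi i)) + (1 - permOp θ 1)) = _
  rw [mul_add, mul_sub, permOp_mul H.idem, permOp_one_mul_self H.idem, mul_one, mul_one, sub_self,
    add_zero, sigmaOp]

theorem tensorRep_kappa (H : IsTriple θ θhat θcheck ω) (i : Fin (j - 1)) :
    tensorRep H (kappa j ω (i + 1)) = kappaOp θ θhat θcheck i := by
  change permOp θ 1 * unitalHom H _ = _
  have h : 1 ≤ (i : ℕ) + 1 ∧ (i : ℕ) + 1 < j := by omega
  rw [kappa, dif_pos h, unitalHom_mk, freeKappa, FreeAlgebra.lift_ι_apply]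
  exact one_mul_capOp H (lo_ne_hi i)

end Representation

/-! ### The pseudo-Euclidean space `ℝ^{p,q}` and the matrix `Θ(k)` -/

/-- Indices of coordinates in `ℝ^{p,q}`: first `p` positive ones, then `q` negative ones. -/
abbrev Idx (p q : ℕ) : Type := Fin p ⊕ Fin q

/-- Diagonal entries of the metric `η = diag(1, …, 1, -1, …, -1)`. -/
def eta (p q : ℕ) : Idx p q → ℝ := Sum.elim (fun _ => 1) (fun _ => -1)

/-- Lowering of an index: `u_n = η_{nm} u^m`. -/
def lower {p q : ℕ} (u : Idx p q → ℝ) (n : Idx p q) : ℝ := eta p q n * u n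

/-- `k^2 = k^n k_n`. -/
def sq {p q : ℕ} (k : Idx p q → ℝ) : ℝ := ∑ n, k n * lower k n

/-- `Θ^n_r(k) = δ^n_r - k_r k^n / k^2`, with row `n` and column `r`. -/
noncomputable def Theta {p q : ℕ} (k : Idx p q → ℝ) : Matrix (Idx p q) (Idx p q) ℝ :=
  Matrix.of fun n r => (if n = r then 1 else 0) - lower k r * k n / sq k

/-- `Θcheck^{nm} = Θ^n_l η^{lm}`. -/
noncomputable def ThetaCheck {p q : ℕ} (k : Idx p q → ℝ) : Matrix (Idx p q) (Idx p q) ℝ :=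
  Theta k * Matrix.diagonal (eta p q)

/-- `Θhat_{mn} = Θ^l_m η_{ln}`. -/
noncomputable def ThetaHat {p q : ℕ} (k : Idx p q → ℝ) : Matrix (Idx p q) (Idx p q) ℝ :=
  (Theta k).transpose * Matrix.diagonal (eta p q)

/-- Entrywise inclusion of real matrices into complex ones. -/
def toComplex {α β : Type} (M : Matrix α β ℝ) : Matrix α β ℂ := M.map Complex.ofReal

theorem eta_mul_eta {p q : ℕ} (n : Idx p q) : eta p q n * eta p q n = 1 := by
  cases n <;> simp [eta]

theorem Theta_mul_vec {p q : ℕ} {k : Idx p q → ℝ} (hk : sq k ≠ 0) (n : Idx p q) :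
    ∑ m, Theta k n m * k m = 0 := by
  simp only [Theta, Matrix.of_apply, sub_mul, Finset.sum_sub_distrib]
  have h : ∑ m, lower k m * k n / sq k * k m = k n / sq k * sq k := by
    have e : sq k = ∑ m, k m * lower k m := rfl
    conv_rhs => enter [2]; rw [e]
    rw [Finset.mul_sum]
    exact Finset.sum_congr rfl fun m _ => by ring
  rw [h, div_mul_cancel₀ _ hk]
  simp

theorem Theta_idem {p q : ℕ} {k : Idx p q → ℝ} (hk : sq k ≠ 0) :
    Theta k * Theta k = Theta k := by
  ext n r
  rw [Matrix.mul_apply]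
  have h : ∀ m, Theta k n m * Theta k m r =
      Theta k n m * (if m = r then 1 else 0) - lower k r / sq k * (Theta k n m * k m) := fun m => by
    rw [show Theta k m r = (if m = r then 1 else 0) - lower k r * k m / sq k from rfl]
    ring
  simp only [h, Finset.sum_sub_distrib, ← Finset.mul_sum, Theta_mul_vec hk]
  simp

theorem diag_mul_Theta {p q : ℕ} (k : Idx p q → ℝ) :
    Matrix.diagonal (eta p q) * Theta k = (Theta k).transpose * Matrix.diagonal (eta p q) := by
  ext n r
  rw [Matrix.diagonal_mul, Matrix.mul_diagonal]
  simp only [Theta, Matrix.of_apply, Matrix.transpose_apply, lower]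
  by_cases h : n = r
  · subst h; simp; ring
  · rw [if_neg h, if_neg (Ne.symm h)]; ring

theorem Theta_mul_diag {p q : ℕ} (k : Idx p q → ℝ) :
    Theta k * Matrix.diagonal (eta p q) = Matrix.diagonal (eta p q) * (Theta k).transpose := by
  have h := congrArg (fun M => Matrix.diagonal (eta p q) * M * Matrix.diagonal (eta p q))
    (diag_mul_Theta k)
  have e : Matrix.diagonal (eta p q) * Matrix.diagonal (eta p q) = 1 := by
    rw [Matrix.diagonal_mul_diagonal]
    simp [eta_mul_eta]
  simp only [← mul_assoc] at h
  rw [e, one_mul, mul_assoc, mul_assoc, e, mul_one] at h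
  exact h

theorem Theta_trace {p q : ℕ} {k : Idx p q → ℝ} (hk : sq k ≠ 0) :
    (Theta k).trace = (p : ℝ) + q - 1 := by
  have h : ∑ x, lower k x * k x / sq k = 1 := by
    rw [← Finset.sum_div, div_eq_one_iff_eq hk, sq]
    exact Finset.sum_congr rfl fun m _ => by ring
  simp [Matrix.trace, Theta, Matrix.diag, Finset.sum_sub_distrib, h]

/-- The triple built from `Θ(k)`, with `ω = D - 1`, `D = p + q`. -/
theorem Theta_isTriple {p q : ℕ} {k : Idx p q → ℝ} (hk : sq k ≠ 0) :
    IsTriple (toComplex (Theta k)) (toComplex (ThetaHat k)) (toComplex (ThetaCheck k))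
      ((p : ℂ) + q - 1) := by
  have hm : ∀ A B : Matrix (Idx p q) (Idx p q) ℝ,
      toComplex A * toComplex B = toComplex (A * B) := fun A B =>
    (Matrix.map_mul (f := Complex.ofRealHom)).symm
  have e : Matrix.diagonal (eta p q) * Matrix.diagonal (eta p q) = 1 := by
    rw [Matrix.diagonal_mul_diagonal]
    simp [eta_mul_eta]
  have hi := Theta_idem hk
  have hit : (Theta k).transpose * (Theta k).transpose = (Theta k).transpose := by
    rw [← Matrix.transpose_mul, hi]
  constructor
  · rw [hm, hi]
  · rw [hm, ThetaCheck, ThetaHat, ← diag_mul_Theta, mul_assoc, ← mul_assoc (Matrix.diagonal _), e,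
      one_mul, hi]
  · rw [hm, ThetaCheck, ← mul_assoc, hi]
  · rw [hm, ThetaHat, mul_assoc, diag_mul_Theta, ← mul_assoc, hit]
  · rw [toComplex, ← Matrix.transpose_map, ThetaCheck, Matrix.transpose_mul,
      Matrix.diagonal_transpose, ← Theta_mul_diag]
  · rw [toComplex, ← Matrix.transpose_map, ThetaHat, Matrix.transpose_mul,
      Matrix.diagonal_transpose, Matrix.transpose_transpose, diag_mul_Theta]
  · have h : (toComplex (Theta k)).trace = ((Theta k).trace : ℂ) := by
      simp [toComplex, Matrix.trace]
    rw [h, Theta_trace hk]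
    push_cast
    rfl

/-- The representation `S_{(k)}` of `Br_j(D - 1)` built from `Θ(k)`. -/
noncomputable def momentumRep {p q : ℕ} (j : ℕ) (k : Idx p q → ℝ) (hk : sq k ≠ 0) :
    BrauerAlgebra j ((p : ℂ) + q - 1) →ₙₐ[ℂ]
      Matrix (Fin j → Idx p q) (Fin j → Idx p q) ℂ :=
  tensorRep (Theta_isTriple hk)

/-- The image `Θ_{[j];j}` of the complete symmetrizer. -/
noncomputable def symmetrizerImage {p q : ℕ} (j : ℕ) (k : Idx p q → ℝ) (hk : sq k ≠ 0) :
    Matrix (Fin j → Idx p q) (Fin j → Idx p q) ℂ :=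
  momentumRep j k hk (symmetrizer j ((p : ℂ) + q - 1))

/-! ### Behrends–Fronsdal projectors

Operators on rank `j` tensors over `ℝ^{p,q}` are real matrices: the row is the upper multi-index
`n_1 … n_j`, the column is the lower multi-index `r_1 … r_j`. -/

/-- The defining properties of a Behrends–Fronsdal projector. Hermiticity is self-adjointness for
the form on tensors induced by `η`: the components with all indices lowered are symmetric under
exchange of the two multi-indices. -/
structure IsBehrendsFronsdal {p q j : ℕ} (k : Idx p q → ℝ)
    (T : Matrix (Fin j → Idx p q) (Fin j → Idx p q) ℝ) : Prop where
  idem : T * T = T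
  hermitian : ∀ n r, (∏ m, eta p q (n m)) * T n r = (∏ m, eta p q (r m)) * T r n
  symm_lower : ∀ (a b : Fin j) n r, T n (r ∘ Equiv.swap a b) = T n r
  symm_upper : ∀ (a b : Fin j) n r, T (n ∘ Equiv.swap a b) r = T n r
  transverse_lower : ∀ (a : Fin j) n r, ∑ x, k x * T n (Function.update r a x) = 0
  transverse_upper : ∀ (a : Fin j) n r, ∑ x, lower k x * T (Function.update n a x) r = 0
  traceless_lower : ∀ (a b : Fin j), a ≠ b → ∀ n r,
    ∑ x, eta p q x * T n (Function.update (Function.update r a x) b x) = 0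
  traceless_upper : ∀ (a b : Fin j), a ≠ b → ∀ n r,
    ∑ x, eta p q x * T (Function.update (Function.update n a x) b x) r = 0

/-- Completely symmetric, transverse and traceless tensors `φ^{n_1 … n_j}`. -/
structure IsSymmetricTT {p q j : ℕ} (k : Idx p q → ℝ) (φ : (Fin j → Idx p q) → ℝ) : Prop where
  symm : ∀ (a b : Fin j) n, φ (n ∘ Equiv.swap a b) = φ n
  transverse : ∀ (a : Fin j) n, ∑ x, lower k x * φ (Function.update n a x) = 0
  traceless : ∀ (a b : Fin j), a ≠ b → ∀ n,
    ∑ x, eta p q x * φ (Function.update (Function.update n a x) b x) = 0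

/-- `T` projects onto the whole space of completely symmetric TT-tensors. -/
def IsOntoSymmetricTT {p q j : ℕ} (k : Idx p q → ℝ)
    (T : Matrix (Fin j → Idx p q) (Fin j → Idx p q) ℝ) : Prop :=
  Set.range T.mulVec = {φ | IsSymmetricTT k φ}

/-- The generating function `T(x,u) = u_{n_1} ⋯ u_{n_j} T^{n_1…n_j}_{r_1…r_j} x^{r_1} ⋯ x^{r_j}`. -/
noncomputable def genFun {p q j : ℕ} (T : Matrix (Fin j → Idx p q) (Fin j → Idx p q) ℝ)
    (x u : Idx p q → ℝ) : ℝ :=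
  ∑ n, ∑ r, (∏ m, lower u (n m)) * T n r * ∏ m, x (r m)

/-- `Θ^{(u)}_{(x)} = x^r u_n Θ^n_r(k)`. -/
noncomputable def thetaForm {p q : ℕ} (k x u : Idx p q → ℝ) : ℝ :=
  ∑ r, ∑ n, x r * lower u n * Theta k n r

/-- The coefficients
`a_A = (-1/2)^A j! / ((j-2A)! A! (2j+D-5)(2j+D-7)⋯(2j+D-2A-3))`, for `2A ≤ j`. -/
noncomputable def bfCoeff (D j A : ℕ) : ℝ :=
  (-1 / 2) ^ A * (j.factorial : ℝ) /
    (((j - 2 * A).factorial : ℝ) * (A.factorial : ℝ) *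
      ∏ B ∈ Finset.Icc 1 A, (2 * (j : ℝ) + (D : ℝ) - 2 * (B : ℝ) - 3))

/-- The explicit generating function of the spin `j` projector. -/
noncomputable def bfGenFun {p q : ℕ} (j : ℕ) (k x u : Idx p q → ℝ) : ℝ :=
  ∑ A ∈ Finset.range (j / 2 + 1), bfCoeff (p + q) j A *
    (thetaForm k u u * thetaForm k x x) ^ A * thetaForm k x u ^ (j - 2 * A)

end BF

/-! Write `P_{lm}` and `K_{lm}` for the flip and the cap on two slots, and `Y` for the sum of
`P_{lm} - K_{lm}` over the slots `l` of a set `S` not containing `m`; the Jucys–Murphy elements act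
by such `Y`. Call a tensor harmonic on `S` if `θ^{⊗n}` fixes it and it is symmetric and traceless in
the slots of `S`. The symmetrizer makes a tensor harmonic one slot at a time. If `x` is harmonic on
`S`, the factor `Y + ω + |S| - 2` removes all traces over a slot of `S` and `m`, and then `Y + 1`
symmetrizes over `S ∪ {m}` (`IsHarmonicOn.step`). On a tensor harmonic in all slots `Y` is the
scalar `|S|`, so the product of all factors is exactly the normalizing constant of the symmetrizer
(`harmonicOp_mulVec_of_isHarmonicOn`). Hence the image of the symmetrizer maps into the harmonic
tensors and fixes them. For `θ = Θ(k)` and `D ≥ 2` these are the symmetric, transverse, traceless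
tensors (`isHarmonicOn_iff`).

The operators `Y` of successive slots commute and are self-adjoint for `η`, hence so is their
product. Self-adjointness moves the properties of the upper indices to the lower ones
(`IsBehrendsFronsdal.of_hermitian`) and makes a projector with given image unique
(`IsBehrendsFronsdal.eq_of_isOnto`).

For the generating function let `Π_n` be the rank `n` projector. Since `Π_{n+1}` absorbs `Θ ⊗ Π_n`,
it may be applied to `ψ = Θx ⊗ Π_n x^{⊗n}`, which is harmonic outside the first slot. A single step
with that slot computes `Π_{n+1} ψ`; contraction with `u` gives `N g_{n+1} = N Θ^{(u)}_{(x)} g_n -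
Θ^{(u)}_{(u)} ∂ g_n`, where `N = D + 2n - 3` and `∂` differentiates in `u` along `Θx`
(`genFun_spinProjector_succ`). The explicit polynomials obey the same recursion
(`sum_bfCoeff_succ`), which determines them because `N > 0`. -/

namespace BF

open scoped Matrix

/-! ### Adding one slot to a harmonic tensor. -/

section HarmonicStep

variable {ι R : Type} [Fintype ι] [CommRing R] {n : ℕ}
  {θ θhat θcheck : Matrix ι ι R} {ω : R}

/-- The difference of the flip and the cap on the slots `l`, `m`. -/
def flipSubCap (θ θhat θcheck : Matrix ι ι R) (l m : Fin n) :
    Matrix (Fin n → ι) (Fin n → ι) R :=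
  permOp θ (Equiv.swap l m) - capOp θ θhat θcheck l m

/-- The sum of `flipSubCap` over the pairs formed by `m` and a slot of `S`. For `S` the set of all
slots before `m` this represents a Jucys–Murphy element. -/
def jmOp (θ θhat θcheck : Matrix ι ι R) (S : Finset (Fin n)) (m : Fin n) :
    Matrix (Fin n → ι) (Fin n → ι) R :=
  ∑ l ∈ S, flipSubCap θ θhat θcheck l m

/-- The tensor `x` is, in the slots of `S`, symmetric and traceless, and it lies in the image of
`θ^{⊗ n}`. -/
structure IsHarmonicOn (θ θhat θcheck : Matrix ι ι R) (S : Finset (Fin n))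
    (x : (Fin n → ι) → R) : Prop where
  proj : permOp θ 1 *ᵥ x = x
  swap : ∀ a ∈ S, ∀ b ∈ S, permOp θ (Equiv.swap a b) *ᵥ x = x
  cap : ∀ a ∈ S, ∀ b ∈ S, a ≠ b → capOp θ θhat θcheck a b *ᵥ x = 0

theorem permOp_mul_swap (h : θ * θ = θ) (π : Equiv.Perm (Fin n)) (a b : Fin n) :
    permOp θ π * permOp θ (Equiv.swap (π a) (π b)) = permOp θ (Equiv.swap a b) * permOp θ π := by
  rw [permOp_mul h, permOp_mul h, Equiv.swap_apply_apply, inv_mul_cancel_right]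

/-- Moving a permutation across only relabels the slots, for the flip and the cap alike. -/
theorem permOp_mul_flipSubCap (H : IsTriple θ θhat θcheck ω) (π : Equiv.Perm (Fin n)) {a b : Fin n}
    (hab : a ≠ b) :
    permOp θ π * flipSubCap θ θhat θcheck (π a) (π b) =
      flipSubCap θ θhat θcheck a b * permOp θ π := by
  rw [flipSubCap, flipSubCap, mul_sub, sub_mul, permOp_mul_swap H.idem, permOp_mul_capOp H π hab]

theorem one_mul_flipSubCap (H : IsTriple θ θhat θcheck ω) {a b : Fin n} (hab : a ≠ b) :
    permOp θ 1 * flipSubCap θ θhat θcheck a b = flipSubCap θ θhat θcheck a b := by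
  rw [flipSubCap, mul_sub, permOp_mul H.idem, one_mul_capOp H hab, mul_one]

theorem commute_one_jmOp (H : IsTriple θ θhat θcheck ω) {S : Finset (Fin n)} {m : Fin n}
    (hm : m ∉ S) : Commute (permOp θ 1) (jmOp θ θhat θcheck S m) :=
  Commute.sum_right _ _ _ fun _ hl =>
    permOp_mul_flipSubCap H 1 (ne_of_mem_of_not_mem hl hm)

/-- A transposition inside `S` fixes `m` and merely permutes the summands. -/
theorem commute_swap_jmOp (H : IsTriple θ θhat θcheck ω) {S : Finset (Fin n)} {m a b : Fin n}
    (hm : m ∉ S) (ha : a ∈ S) (hb : b ∈ S) :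
    Commute (permOp θ (Equiv.swap a b)) (jmOp θ θhat θcheck S m) := by
  have hS : ∀ l, Equiv.swap a b l ∈ S ↔ l ∈ S := fun l => by
    rw [Equiv.swap_apply_def]
    split_ifs <;> simp_all
  have hm' : Equiv.swap a b m = m :=
    Equiv.swap_apply_of_ne_of_ne (ne_of_mem_of_not_mem ha hm).symm
      (ne_of_mem_of_not_mem hb hm).symm
  rw [Commute, SemiconjBy, jmOp, Finset.mul_sum, Finset.sum_mul]
  refine (Finset.sum_equiv (Equiv.swap a b) (fun l => (hS l).symm) fun l hl => ?_).symm
  have h := permOp_mul_flipSubCap H (Equiv.swap a b) (ne_of_mem_of_not_mem hl hm)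
  rw [hm'] at h
  exact h.symm

theorem cap_mul_swap (H : IsTriple θ θhat θcheck ω) {a b m : Fin n} (hab : a ≠ b)
    (hbm : b ≠ m) :
    capOp θ θhat θcheck a b * permOp θ (Equiv.swap a m) =
      permOp θ (Equiv.swap a m) * capOp θ θhat θcheck m b := by
  have h := permOp_mul_capOp H (Equiv.swap a m) hab
  rwa [Equiv.swap_apply_left, Equiv.swap_apply_of_ne_of_ne hab.symm hbm, eq_comm] at h

/-- The four terms cancel crosswise: `K_{ab} P_{am}` and `K_{ab} K_{bm}` both equal `P_{am} K_{bm}`,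
and likewise with `a` and `b` exchanged. -/
theorem cap_mul_flipSubCap_add (H : IsTriple θ θhat θcheck ω) {a b m : Fin n} (hab : a ≠ b)
    (ham : a ≠ m) (hbm : b ≠ m) :
    capOp θ θhat θcheck a b * (flipSubCap θ θhat θcheck a m + flipSubCap θ θhat θcheck b m) =
      0 := by
  have h1 := cap_mul_swap H hab hbm
  have h2 := cap_mul_swap H hab.symm ham
  have h3 := capOp_mul_capOp H hab hbm ham
  have h4 := capOp_mul_capOp H hab.symm ham hbm
  rw [capOp_comm H b a] at h2 h4
  rw [flipSubCap, flipSubCap, mul_add, mul_sub, mul_sub, h1, h2, h3, h4, capOp_comm H m b,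
    capOp_comm H m a]
  abel

theorem flipSubCap_add_mul_cap (H : IsTriple θ θhat θcheck ω) {a b m : Fin n} (hab : a ≠ b)
    (ham : a ≠ m) (hbm : b ≠ m) :
    (flipSubCap θ θhat θcheck a m + flipSubCap θ θhat θcheck b m) * capOp θ θhat θcheck a b =
      0 := by
  have h3 := capOp_mul_capOp H ham.symm hab hbm.symm
  have h4 := capOp_mul_capOp H hbm.symm hab.symm ham.symm
  rw [capOp_comm H b a] at h4
  rw [flipSubCap, flipSubCap, add_mul, sub_mul, sub_mul, capOp_comm H a m, capOp_comm H b m, h3,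
    h4, Equiv.swap_comm m b, Equiv.swap_comm m a]
  abel

theorem commute_cap_flipSubCap (H : IsTriple θ θhat θcheck ω) {a b l m : Fin n} (hab : a ≠ b)
    (hlm : l ≠ m) (hal : a ≠ l) (ham : a ≠ m) (hbl : b ≠ l) (hbm : b ≠ m) :
    Commute (capOp θ θhat θcheck a b) (flipSubCap θ θhat θcheck l m) := by
  refine Commute.sub_right ?_ (capOp_mul_comm H hab hlm hal ham hbl hbm)
  have h := permOp_mul_capOp H (Equiv.swap l m) hab
  rw [Equiv.swap_apply_of_ne_of_ne hal ham, Equiv.swap_apply_of_ne_of_ne hbl hbm] at h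
  exact h.symm

/-- Only the summands `l = a` and `l = b` share a slot with the cap, and their sum is annihilated by
it from both sides. The other summands commute one by one. -/
theorem commute_cap_jmOp (H : IsTriple θ θhat θcheck ω) {S : Finset (Fin n)} {m a b : Fin n}
    (hm : m ∉ S) (ha : a ∈ S) (hb : b ∈ S) (hab : a ≠ b) :
    Commute (capOp θ θhat θcheck a b) (jmOp θ θhat θcheck S m) := by
  have ham := ne_of_mem_of_not_mem ha hm
  have hbm := ne_of_mem_of_not_mem hb hm
  have e : jmOp θ θhat θcheck S m = flipSubCap θ θhat θcheck a m + flipSubCap θ θhat θcheck b m +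
      ∑ l ∈ (S.erase a).erase b, flipSubCap θ θhat θcheck l m := by
    rw [jmOp, ← Finset.add_sum_erase S _ ha,
      ← Finset.add_sum_erase (S.erase a) _ (Finset.mem_erase.2 ⟨hab.symm, hb⟩), add_assoc]
  rw [e]
  refine Commute.add_right ?_ (Commute.sum_right _ _ _ fun l hl => ?_)
  · rw [Commute, SemiconjBy, cap_mul_flipSubCap_add H hab ham hbm,
      flipSubCap_add_mul_cap H hab ham hbm]
  · simp only [Finset.mem_erase] at hl
    exact commute_cap_flipSubCap H hab (ne_of_mem_of_not_mem hl.2.2 hm) hl.2.1.symm ham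
      hl.1.symm hbm

/-- The first operator is built from flips and caps inside `S`, each of which commutes with the
second. -/
theorem commute_jmOp_jmOp (H : IsTriple θ θhat θcheck ω) {S S' : Finset (Fin n)} {l m : Fin n}
    (hm : m ∉ S) (hl : l ∈ S) (hS : S' ⊆ S) (hlS : l ∉ S') :
    Commute (jmOp θ θhat θcheck S' l) (jmOp θ θhat θcheck S m) :=
  Commute.sum_left _ _ _ fun _ ha =>
    Commute.sub_left (commute_swap_jmOp H hm (hS ha) hl)
      (commute_cap_jmOp H hm (hS ha) hl (ne_of_mem_of_not_mem ha hlS))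

theorem IsHarmonicOn.of_commute {S : Finset (Fin n)}
    {x : (Fin n → ι) → R} (hx : IsHarmonicOn θ θhat θcheck S x)
    {Y : Matrix (Fin n → ι) (Fin n → ι) R} (h1 : Commute (permOp θ 1) Y)
    (h2 : ∀ a ∈ S, ∀ b ∈ S, Commute (permOp θ (Equiv.swap a b)) Y)
    (h3 : ∀ a ∈ S, ∀ b ∈ S, a ≠ b → Commute (capOp θ θhat θcheck a b) Y) :
    IsHarmonicOn θ θhat θcheck S (Y *ᵥ x) where
  proj := by rw [Matrix.mulVec_mulVec, h1.eq, ← Matrix.mulVec_mulVec, hx.proj]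
  swap a ha b hb := by
    rw [Matrix.mulVec_mulVec, (h2 a ha b hb).eq, ← Matrix.mulVec_mulVec, hx.swap a ha b hb]
  cap a ha b hb hab := by
    rw [Matrix.mulVec_mulVec, (h3 a ha b hb hab).eq, ← Matrix.mulVec_mulVec, hx.cap a ha b hb hab,
      Matrix.mulVec_zero]

/-- Each flip acts as `1` and each cap as `0`, so every slot of `S` contributes `1`. -/
theorem IsHarmonicOn.jmOp_mulVec {S S' : Finset (Fin n)} {m : Fin n} (hm : m ∈ S') (hmS : m ∉ S)
    (hS : S ⊆ S') {x : (Fin n → ι) → R} (hx : IsHarmonicOn θ θhat θcheck S' x) :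
    jmOp θ θhat θcheck S m *ᵥ x = (S.card : R) • x := by
  rw [jmOp, Matrix.sum_mulVec, Finset.sum_congr rfl (g := fun _ => x), Finset.sum_const,
    Nat.cast_smul_eq_nsmul]
  intro l hl
  rw [flipSubCap, Matrix.sub_mulVec, hx.swap l (hS hl) m hm,
    hx.cap l (hS hl) m hm (ne_of_mem_of_not_mem hl hmS), sub_zero]

theorem IsHarmonicOn.smul {S : Finset (Fin n)} {x : (Fin n → ι) → R}
    (hx : IsHarmonicOn θ θhat θcheck S x) (c : R) : IsHarmonicOn θ θhat θcheck S (c • x) where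
  proj := by rw [Matrix.mulVec_smul, hx.proj]
  swap a ha b hb := by rw [Matrix.mulVec_smul, hx.swap a ha b hb]
  cap a ha b hb hab := by rw [Matrix.mulVec_smul, hx.cap a ha b hb hab, smul_zero]

variable [DecidableEq ι]

theorem IsHarmonicOn.jmOp_add_smul_mulVec (H : IsTriple θ θhat θcheck ω) {S : Finset (Fin n)}
    {m : Fin n} (hm : m ∉ S) {x : (Fin n → ι) → R}
    (hx : IsHarmonicOn θ θhat θcheck S x) (c : R) :
    IsHarmonicOn θ θhat θcheck S ((jmOp θ θhat θcheck S m + c • 1) *ᵥ x) := by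
  have hc : ∀ Z : Matrix (Fin n → ι) (Fin n → ι) R, Commute Z (c • 1) := fun Z =>
    (Commute.one_right Z).smul_right c
  exact hx.of_commute ((commute_one_jmOp H hm).add_right (hc _))
    (fun a ha b hb => (commute_swap_jmOp H hm ha hb).add_right (hc _))
    (fun a ha b hb hab => (commute_cap_jmOp H hm ha hb hab).add_right (hc _))

/-- Adding `ω + |S| - 2` to `jmOp` makes the traces over a slot of `S` and the slot `m` vanish. -/
theorem IsHarmonicOn.cap_mul_jmOp_add_smul_mulVec (H : IsTriple θ θhat θcheck ω)
    {S : Finset (Fin n)} {m l : Fin n} (hm : m ∉ S) (hl : l ∈ S) {x : (Fin n → ι) → R}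
    (hx : IsHarmonicOn θ θhat θcheck S x) :
    capOp θ θhat θcheck l m *ᵥ
      ((jmOp θ θhat θcheck S m + (ω + (S.card : R) - 2) • 1) *ᵥ x) = 0 := by
  have hlm := ne_of_mem_of_not_mem hl hm
  have h1 : capOp θ θhat θcheck l m * flipSubCap θ θhat θcheck l m =
      (1 - ω) • capOp θ θhat θcheck l m := by
    rw [flipSubCap, mul_sub, capOp_mul_swap H hlm, capOp_mul_self H hlm, sub_smul, one_smul]
  -- For `b ≠ l` the flip carries the cap to one inside `S`, which kills `x`; the product of two
  -- caps is the cap times a flip inside `S`, which fixes `x`. The total coefficient is then `(1 -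
  -- ω) - (|S| - 1) + (ω + |S| - 2) = 0`.
  have h2 : ∀ b ∈ S.erase l, (capOp θ θhat θcheck l m * flipSubCap θ θhat θcheck b m) *ᵥ x =
      -(capOp θ θhat θcheck l m *ᵥ x) := fun b hb => by
    obtain ⟨hbl, hb⟩ := Finset.mem_erase.1 hb
    have hbm := ne_of_mem_of_not_mem hb hm
    have h3 := cap_mul_swap H hlm.symm hbl.symm
    have h4 := permOp_mul_capOp H (Equiv.swap l b) hlm
    rw [Equiv.swap_apply_left, Equiv.swap_apply_of_ne_of_ne hlm.symm hbm.symm] at h4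
    rw [flipSubCap, mul_sub, Matrix.sub_mulVec, capOp_comm H l m, Equiv.swap_comm b m, h3,
      ← Matrix.mulVec_mulVec, hx.cap b hb l hl hbl, Matrix.mulVec_zero, zero_sub, capOp_comm H m l,
      capOp_comm H b m, capOp_mul_capOp H hlm hbm.symm hbl.symm, capOp_comm H m b, h4,
      ← Matrix.mulVec_mulVec, hx.swap l hl b hb]
  have h5 : ((S.erase l).card : R) = S.card - 1 := by
    rw [Finset.card_erase_of_mem hl, Nat.cast_sub (Finset.card_pos.2 ⟨l, hl⟩), Nat.cast_one]
  rw [Matrix.add_mulVec, Matrix.mulVec_add, jmOp, ← Finset.add_sum_erase S _ hl, Matrix.add_mulVec,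
    Matrix.mulVec_add, Matrix.mulVec_mulVec, h1, Matrix.sum_mulVec, Matrix.mulVec_sum]
  simp only [Matrix.mulVec_mulVec]
  rw [Finset.sum_congr rfl h2, Finset.sum_const, ← Nat.cast_smul_eq_nsmul R, h5]
  simp only [mul_smul_comm, mul_one, Matrix.smul_mulVec]
  module

/-- One step of the construction of the complete symmetrizer. -/
theorem IsHarmonicOn.step (H : IsTriple θ θhat θcheck ω) {S : Finset (Fin n)} {m : Fin n}
    (hm : m ∉ S) {x : (Fin n → ι) → R} (hx : IsHarmonicOn θ θhat θcheck S x) :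
    IsHarmonicOn θ θhat θcheck (insert m S)
      ((jmOp θ θhat θcheck S m + (1 : R) • 1) *ᵥ
        ((jmOp θ θhat θcheck S m + (ω + (S.card : R) - 2) • 1) *ᵥ x)) := by
  have hχ := hx.jmOp_add_smul_mulVec H hm (ω + (S.card : R) - 2)
  have hc : ∀ l ∈ S, _ := fun l hl => hx.cap_mul_jmOp_add_smul_mulVec H hm hl
  set χ := (jmOp θ θhat θcheck S m + (ω + (S.card : R) - 2) • 1) *ᵥ x with hχdef
  clear_value χ
  have hΞ := hχ.jmOp_add_smul_mulVec H hm 1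
  -- The mixed caps vanish on `χ`, so `Y + 1` is the sum of the identity and the flips with `m`:
  -- coset representatives of the permutations of `S` in those of `S ∪ {m}`.
  have e : (jmOp θ θhat θcheck S m + (1 : R) • 1) *ᵥ χ =
      χ + ∑ l ∈ S, permOp θ (Equiv.swap l m) *ᵥ χ := by
    rw [one_smul, Matrix.add_mulVec, Matrix.one_mulVec, add_comm, jmOp, Matrix.sum_mulVec]
    congr 1
    refine Finset.sum_congr rfl fun l hl => ?_
    rw [flipSubCap, Matrix.sub_mulVec, hc l hl, sub_zero]
  -- The flip of `l` and `m` exchanges the summands `χ` and `P_{lm} χ`. It fixes every other one,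
  -- because `P_{lm} P_{bm} = P_{bm} P_{bl}` and `P_{bl} χ = χ`.
  have hs : ∀ l ∈ S, permOp θ (Equiv.swap l m) *ᵥ ((jmOp θ θhat θcheck S m + (1 : R) • 1) *ᵥ χ) =
      (jmOp θ θhat θcheck S m + (1 : R) • 1) *ᵥ χ := fun l hl => by
    have hlm := ne_of_mem_of_not_mem hl hm
    have h1 : ∀ b ∈ S.erase l, permOp θ (Equiv.swap l m) *ᵥ (permOp θ (Equiv.swap b m) *ᵥ χ) =
        permOp θ (Equiv.swap b m) *ᵥ χ := fun b hb => by
      obtain ⟨hbl, hb⟩ := Finset.mem_erase.1 hb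
      have h3 := permOp_mul_swap H.idem (Equiv.swap b m) m l
      rw [Equiv.swap_apply_right,
        Equiv.swap_apply_of_ne_of_ne hbl.symm hlm, Equiv.swap_comm m l] at h3
      rw [Matrix.mulVec_mulVec, ← h3, ← Matrix.mulVec_mulVec, hχ.swap b hb l hl]
    rw [e, Matrix.mulVec_add, Matrix.mulVec_sum, ← Finset.add_sum_erase S _ hl,
      Finset.sum_congr rfl h1, Matrix.mulVec_mulVec, permOp_mul H.idem, Equiv.swap_mul_self,
      hχ.proj,
      ← Finset.add_sum_erase S (fun l => permOp θ (Equiv.swap l m) *ᵥ χ) hl]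
    abel
  -- Symmetrizing creates no trace: for `b ≠ l` the flip turns the cap into one inside `S`, and for
  -- `b = l` the cap absorbs it.
  have hcap : ∀ l ∈ S, capOp θ θhat θcheck l m *ᵥ
      ((jmOp θ θhat θcheck S m + (1 : R) • 1) *ᵥ χ) = 0 := fun l hl => by
    have hlm := ne_of_mem_of_not_mem hl hm
    rw [e, Matrix.mulVec_add, hc l hl, zero_add, Matrix.mulVec_sum]
    refine Finset.sum_eq_zero fun b hb => ?_
    rw [Matrix.mulVec_mulVec]
    by_cases hbl : b = l
    · rw [hbl, capOp_mul_swap H hlm, hc l hl]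
    · have hbm := ne_of_mem_of_not_mem hb hm
      rw [capOp_comm H l m, Equiv.swap_comm b m,
        cap_mul_swap H hlm.symm (Ne.symm hbl), ← Matrix.mulVec_mulVec, hχ.cap b hb l hl hbl,
        Matrix.mulVec_zero]
  refine ⟨hΞ.proj, fun a ha b hb => ?_, fun a ha b hb hab => ?_⟩
  · rcases Finset.mem_insert.1 ha with hm1 | ha <;> rcases Finset.mem_insert.1 hb with hm2 | hb
    · rw [hm1, hm2, Equiv.swap_self]
      exact hΞ.proj
    · rw [hm1, Equiv.swap_comm]
      exact hs b hb
    · rw [hm2]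
      exact hs a ha
    · exact hΞ.swap a ha b hb
  · rcases Finset.mem_insert.1 ha with hm1 | ha <;> rcases Finset.mem_insert.1 hb with hm2 | hb
    · exact absurd (hm1.trans hm2.symm) hab
    · rw [hm1, capOp_comm H]
      exact hcap b hb
    · rw [hm2]
      exact hcap a ha
    · exact hΞ.cap a ha b hb hab

end HarmonicStep

/-! ### The product of all steps and its value on harmonic tensors. -/

section HarmonicOp

variable {ι R : Type} [Fintype ι] [CommRing R] {n : ℕ}
  {θ θhat θcheck : Matrix ι ι R} {ω : R}

/-- The image of the Jucys–Murphy element `y_{m+1}`; the slots are counted from `0`. -/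
def jucysMurphyOp (n : ℕ) (θ θhat θcheck : Matrix ι ι R) (m : ℕ) :
    Matrix (Fin n → ι) (Fin n → ι) R :=
  if h : m < n then jmOp θ θhat θcheck (Finset.Iio ⟨m, h⟩) ⟨m, h⟩ else 0

theorem commute_one_jucysMurphyOp (H : IsTriple θ θhat θcheck ω) (m : ℕ) :
    Commute (permOp θ 1) (jucysMurphyOp n θ θhat θcheck m) := by
  rw [jucysMurphyOp]
  split_ifs with h
  · exact commute_one_jmOp H (by simp)
  · exact Commute.zero_right _

theorem commute_jucysMurphyOp (H : IsTriple θ θhat θcheck ω) (l m : ℕ) :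
    Commute (jucysMurphyOp n θ θhat θcheck l) (jucysMurphyOp n θ θhat θcheck m) := by
  wlog hlm : l ≤ m generalizing l m
  · exact (this m l (le_of_not_ge hlm)).symm
  rcases hlm.eq_or_lt with rfl | hlm
  · exact Commute.refl _
  rw [jucysMurphyOp, jucysMurphyOp]
  split_ifs with h1 h2 h2
  · refine commute_jmOp_jmOp H (by simp) (by simpa using hlm) (fun a ha => ?_) (by simp)
    rw [Finset.mem_Iio] at ha ⊢
    exact ha.trans (by simpa using hlm)
  · exact Commute.zero_right _
  · exact Commute.zero_left _
  · exact Commute.zero_left _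

variable [DecidableEq ι]

/-- The product of the factors `(y_{m+1} + 1) (y_{m+1} + ω + m - 2)`, `1 ≤ m ≤ i`, on the image
of `θ^{⊗ n}`. -/
def harmonicOp (n : ℕ) (θ θhat θcheck : Matrix ι ι R) (ω : R) :
    ℕ → Matrix (Fin n → ι) (Fin n → ι) R
  | 0 => permOp θ 1
  | i + 1 => (jucysMurphyOp n θ θhat θcheck (i + 1) + (1 : R) • 1) *
      ((jucysMurphyOp n θ θhat θcheck (i + 1) + (ω + ((i + 1 : ℕ) : R) - 2) • 1) *
        harmonicOp n θ θhat θcheck ω i)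

theorem insert_Iic {n m : ℕ} (h : m + 1 < n) :
    insert (⟨m + 1, h⟩ : Fin n) (Finset.Iic (⟨m, Nat.lt_of_succ_lt h⟩ : Fin n)) =
      Finset.Iic (⟨m + 1, h⟩ : Fin n) := by
  ext a
  simp only [Finset.mem_insert, Finset.mem_Iic, Fin.le_def, Fin.ext_iff]
  omega

theorem Iio_eq_Iic {n m : ℕ} (h : m + 1 < n) :
    Finset.Iio (⟨m + 1, h⟩ : Fin n) = Finset.Iic (⟨m, Nat.lt_of_succ_lt h⟩ : Fin n) := by
  ext a
  simp only [Finset.mem_Iio, Finset.mem_Iic, Fin.le_def, Fin.lt_def]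
  omega

/-- Induction over the slots. A single slot demands only membership in the image of `θ^{⊗n}`; the
factors of index `i + 1` then adjoin slot `i + 1` to its `i + 1` predecessors. -/
theorem isHarmonicOn_harmonicOp_mulVec (H : IsTriple θ θhat θcheck ω) (x : (Fin n → ι) → R)
    (i : ℕ) (hi : i < n) :
    IsHarmonicOn θ θhat θcheck (Finset.Iic ⟨i, hi⟩) (harmonicOp n θ θhat θcheck ω i *ᵥ x) := by
  induction i with
  | zero =>
    have h0 : ∀ a ∈ Finset.Iic (⟨0, hi⟩ : Fin n), a = ⟨0, hi⟩ := fun a ha =>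
      Fin.ext (Nat.le_zero.1 (Fin.le_def.1 (Finset.mem_Iic.1 ha)))
    have h1 : permOp θ 1 *ᵥ (harmonicOp n θ θhat θcheck ω 0 *ᵥ x) =
        harmonicOp n θ θhat θcheck ω 0 *ᵥ x := by
      rw [harmonicOp, Matrix.mulVec_mulVec, permOp_one_mul_self H.idem]
    refine ⟨h1, fun a ha b hb => ?_, fun a ha b hb hab => ?_⟩
    · rw [h0 a ha, h0 b hb, Equiv.swap_self]
      exact h1
    · exact absurd ((h0 a ha).trans (h0 b hb).symm) hab
  | succ i ih =>
    have h := (ih (Nat.lt_of_succ_lt hi)).step H (m := ⟨i + 1, hi⟩)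
      (by simp [Fin.le_def])
    rw [insert_Iic, ← Iio_eq_Iic hi, Fin.card_Iio] at h
    rwa [harmonicOp, ← Matrix.mulVec_mulVec, ← Matrix.mulVec_mulVec, jucysMurphyOp, dif_pos hi]

/-- Slot `m`, counted from `0`, has `Y = m`, so its two factors give `(m + 1)(ω + 2m - 2)`. Counted
from `1`, the second one is the factor `ω + 2m - 4` of the denominator. -/
theorem harmonicOp_mulVec_of_isHarmonicOn {x : (Fin n → ι) → R}
    (hx : IsHarmonicOn θ θhat θcheck Finset.univ x) (i : ℕ) (hi : i < n) :
    harmonicOp n θ θhat θcheck ω i *ᵥ x =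
      (((i + 1).factorial : R) * ∏ m ∈ Finset.Icc 2 (i + 1), (ω + 2 * (m : R) - 4)) • x := by
  induction i with
  | zero => simp [harmonicOp, hx.proj]
  | succ i ih =>
    have h : jucysMurphyOp n θ θhat θcheck (i + 1) *ᵥ x = ((i + 1 : ℕ) : R) • x := by
      rw [jucysMurphyOp, dif_pos hi, hx.jmOp_mulVec (Finset.mem_univ _) (by simp)
        (Finset.subset_univ _), Fin.card_Iio]
    rw [harmonicOp, ← Matrix.mulVec_mulVec, ← Matrix.mulVec_mulVec,
      ih (Nat.lt_of_succ_lt hi), Finset.prod_Icc_succ_top (a := 2) (b := i + 1) (by omega),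
      Nat.factorial_succ (i + 1)]
    simp only [Matrix.mulVec_smul, Matrix.mulVec_add, Matrix.add_mulVec, Matrix.smul_mulVec,
      Matrix.one_mulVec, h]
    push_cast
    module

end HarmonicOp

/-! ### The Brauer symmetrizer acts as the normalized product of steps. -/

section SymmetrizerImage

variable {ι : Type} [Fintype ι] [DecidableEq ι] {j : ℕ}
  {θ θhat θcheck : Matrix ι ι ℂ} {ω : ℂ}

/-- Conjugation by the successive `σ` drags the second slot of the pair from `a + 1` to `a + 1 + d`.
Generators are numbered from `1` and slots from `0`. -/
theorem tensorRep_sandwich (H : IsTriple θ θhat θcheck ω) (a : Fin j) (d : ℕ)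
    (hd : (a : ℕ) + 1 + d < j) :
    tensorRep H (sandwich j ω (a + 1) d (sigma j ω (a + 1) - kappa j ω (a + 1))) =
      flipSubCap θ θhat θcheck a ⟨a + 1 + d, hd⟩ := by
  induction d with
  | zero =>
    have h1 := tensorRep_sigma H (⟨a, by omega⟩ : Fin (j - 1))
    have h2 := tensorRep_kappa H (⟨a, by omega⟩ : Fin (j - 1))
    rw [sandwich, map_sub]
    exact congrArg₂ _ h1 h2
  | succ d ih =>
    have h1 := tensorRep_sigma H (⟨a + 1 + d, by omega⟩ : Fin (j - 1))
    have h3 : sigmaOp θ (⟨a + 1 + d, by omega⟩ : Fin (j - 1)) =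
        permOp θ (Equiv.swap ⟨a + 1 + d, by omega⟩ ⟨a + 1 + (d + 1), hd⟩) := rfl
    have hne : a ≠ ⟨a + 1 + (d + 1), hd⟩ := fun h => by
      have := congrArg Fin.val h
      simp only at this
      omega
    have hne' : a ≠ ⟨a + 1 + d, by omega⟩ := fun h => by
      have := congrArg Fin.val h
      simp only at this
      omega
    have h4 := permOp_mul_flipSubCap H
      (Equiv.swap ⟨a + 1 + d, by omega⟩ ⟨a + 1 + (d + 1), hd⟩) hne
    rw [Equiv.swap_apply_right, Equiv.swap_apply_of_ne_of_ne hne' hne] at h4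
    rw [sandwich, map_mul, map_mul, h1, h3, ih (by omega), h4, mul_assoc, permOp_mul H.idem,
      Equiv.swap_mul_self]
    have h5 := permOp_mul_flipSubCap H 1 hne
    exact h5.symm.trans (one_mul_flipSubCap H hne)

theorem tensorRep_jucysMurphy (H : IsTriple θ θhat θcheck ω) (m : ℕ) (hm : m < j) :
    tensorRep H (jucysMurphy j ω (m + 1)) = jucysMurphyOp j θ θhat θcheck m := by
  rw [jucysMurphyOp, dif_pos hm, jucysMurphy, map_sum, jmOp]
  symm
  refine Finset.sum_bij (fun a _ => (a : ℕ) + 1) (fun a ha => ?_) (fun a _ b _ h => ?_)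
    (fun b hb => ?_) fun a ha => ?_
  · have := Fin.lt_def.1 (Finset.mem_Iio.1 ha)
    simp only [Finset.mem_Ico] at *
    omega
  · exact Fin.ext (Nat.succ_injective h)
  · rw [Finset.mem_Ico] at hb
    refine ⟨⟨b - 1, by omega⟩, Finset.mem_Iio.2 (Fin.lt_def.2 ?_), ?_⟩ <;> simp only <;> omega
  · have := Fin.lt_def.1 (Finset.mem_Iio.1 ha)
    simp only at this
    rw [tensorRep_sandwich H a _ (by omega)]
    congr
    omega

/-- The representation is not unital: a scalar alone goes to a multiple of `θ^{⊗j}`. To the right of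
another factor it can be pulled out and written as a multiple of the identity matrix. -/
theorem tensorRep_mul_add_smul (H : IsTriple θ θhat θcheck ω) (a b : BrauerAlgebra j ω) (c : ℂ) :
    tensorRep H (a * (b + algebraMap ℂ _ c)) = tensorRep H a * (tensorRep H b + c • 1) := by
  rw [mul_add, map_add, map_mul, mul_add, ← Algebra.commutes c a, ← Algebra.smul_def,
    map_smul, mul_smul_comm, mul_one]

theorem tensorRep_list_prod_succ (H : IsTriple θ θhat θcheck ω) (c : ℕ → ℂ) (i : ℕ)
    (hi : i + 1 < j) :
    tensorRep H ((List.range' 2 (i + 1)).map fun m =>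
        jucysMurphy j ω m + algebraMap ℂ (BrauerAlgebra j ω) (c m)).prod =
      tensorRep H ((List.range' 2 i).map fun m =>
        jucysMurphy j ω m + algebraMap ℂ (BrauerAlgebra j ω) (c m)).prod *
        (jucysMurphyOp j θ θhat θcheck (i + 1) + c (i + 2) • 1) := by
  rw [List.range'_concat, List.map_append, List.prod_append, List.map_singleton,
    List.prod_singleton, tensorRep_mul_add_smul, mul_comm 1 i, mul_one, add_comm 2 i,
    tensorRep_jucysMurphy H (i + 1) hi]

theorem commute_tensorRep_list_prod (H : IsTriple θ θhat θcheck ω) (c : ℕ → ℂ) (i m : ℕ)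
    (hi : i < j) :
    Commute (tensorRep H ((List.range' 2 i).map fun m =>
        jucysMurphy j ω m + algebraMap ℂ (BrauerAlgebra j ω) (c m)).prod)
      (jucysMurphyOp j θ θhat θcheck m) := by
  induction i with
  | zero =>
    rw [List.range'_zero, List.map_nil, List.prod_nil, tensorRep_one, ← permOp_one]
    exact commute_one_jucysMurphyOp H m
  | succ i ih =>
    rw [tensorRep_list_prod_succ H c i hi]
    exact (ih (by omega)).mul_left ((commute_jucysMurphyOp H _ _).add_left
      ((Commute.one_left _).smul_left _))

/-- The symmetrizer lists all symmetrizing factors before all trace-removing ones. Commutativity of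
the Jucys–Murphy operators interleaves them into one pair per slot. -/
theorem tensorRep_list_prod_mul_list_prod (H : IsTriple θ θhat θcheck ω) (i : ℕ) (hi : i < j) :
    tensorRep H ((List.range' 2 i).map fun m =>
        jucysMurphy j ω m + algebraMap ℂ (BrauerAlgebra j ω) 1).prod *
      tensorRep H ((List.range' 2 i).map fun m =>
        jucysMurphy j ω m + algebraMap ℂ (BrauerAlgebra j ω) (ω + (m : ℂ) - 3)).prod =
      harmonicOp j θ θhat θcheck ω i := by
  induction i with
  | zero =>
    simp only [List.range'_zero, List.map_nil, List.prod_nil]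
    rw [tensorRep_one, ← permOp_one, permOp_one_mul_self H.idem, harmonicOp]
  | succ i ih =>
    have h1 := tensorRep_list_prod_succ H (fun _ => 1) i hi
    have h2 := tensorRep_list_prod_succ H (fun m => ω + (m : ℂ) - 3) i hi
    have c1 := commute_tensorRep_list_prod H (fun _ => 1) i (i + 1) (Nat.lt_of_succ_lt hi)
    have c2 := commute_tensorRep_list_prod H (fun m => ω + (m : ℂ) - 3) i (i + 1)
      (Nat.lt_of_succ_lt hi)
    have hc : ω + ((i + 2 : ℕ) : ℂ) - 3 = ω + ((i + 1 : ℕ) : ℂ) - 2 := by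
      push_cast
      ring
    simp only [hc] at h1 h2
    rw [h1, h2, harmonicOp, ← ih (Nat.lt_of_succ_lt hi)]
    set P := tensorRep H ((List.range' 2 i).map fun m =>
        jucysMurphy j ω m + algebraMap ℂ (BrauerAlgebra j ω) 1).prod
    set P' := tensorRep H ((List.range' 2 i).map fun m =>
        jucysMurphy j ω m + algebraMap ℂ (BrauerAlgebra j ω) (ω + (m : ℂ) - 3)).prod
    set Y := jucysMurphyOp j θ θhat θcheck (i + 1)
    have d1 : ∀ c : ℂ, Commute P (Y + c • 1) := fun c =>
      c1.add_right ((Commute.one_right P).smul_right c)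
    have d2 : ∀ c : ℂ, Commute P' (Y + c • 1) := fun c =>
      c2.add_right ((Commute.one_right P').smul_right c)
    rw [(d1 1).eq, (d2 _).eq, mul_assoc, ← mul_assoc P, (d1 _).eq, mul_assoc]

theorem tensorRep_symmetrizer (H : IsTriple θ θhat θcheck ω) (hj : 1 ≤ j) :
    tensorRep H (symmetrizer j ω) =
      ((j.factorial : ℂ) * ∏ m ∈ Finset.Icc 2 j, (ω + 2 * (m : ℂ) - 4))⁻¹ •
        harmonicOp j θ θhat θcheck ω (j - 1) := by
  have h := tensorRep_list_prod_mul_list_prod H (j - 1) (Nat.sub_lt hj one_pos)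
  simp only [map_one] at h
  rw [symmetrizer, map_mul, map_smul, map_smul, smul_mul_smul_comm, h, mul_inv]

end SymmetrizerImage

/-! ### Self-adjointness with respect to a diagonal form. -/

section SelfAdjoint

variable {ι R : Type} [Fintype ι] [DecidableEq ι] [CommRing R] {n : ℕ}
  {θ θhat θcheck : Matrix ι ι R} {ω : R} {ε : ι → R}

/-- Self-adjointness for the diagonal form with entries `∏ m, ε (l m)`. -/
def IsSelfAdjointFor (ε : ι → R) (X : Matrix (Fin n → ι) (Fin n → ι) R) : Prop :=
  Matrix.diagonal (fun l => ∏ m, ε (l m)) * X = Xᵀ * Matrix.diagonal fun l => ∏ m, ε (l m)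

theorem isSelfAdjointFor_iff {X : Matrix (Fin n → ι) (Fin n → ι) R} :
    IsSelfAdjointFor ε X ↔ ∀ l i, (∏ m, ε (l m)) * X l i = (∏ m, ε (i m)) * X i l := by
  rw [IsSelfAdjointFor, ← Matrix.ext_iff]
  refine forall₂_congr fun l i => ?_
  rw [Matrix.diagonal_mul, Matrix.mul_diagonal, Matrix.transpose_apply, mul_comm (X i l)]

theorem IsSelfAdjointFor.mul {X Y : Matrix (Fin n → ι) (Fin n → ι) R}
    (hX : IsSelfAdjointFor ε X) (hY : IsSelfAdjointFor ε Y) (h : Commute X Y) :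
    IsSelfAdjointFor ε (X * Y) := by
  rw [IsSelfAdjointFor] at *
  rw [h.eq, Matrix.transpose_mul, ← h.eq, ← mul_assoc, hX, mul_assoc, hY, mul_assoc]

theorem IsSelfAdjointFor.add {X Y : Matrix (Fin n → ι) (Fin n → ι) R}
    (hX : IsSelfAdjointFor ε X) (hY : IsSelfAdjointFor ε Y) : IsSelfAdjointFor ε (X + Y) := by
  rw [IsSelfAdjointFor] at *
  rw [mul_add, Matrix.transpose_add, add_mul, hX, hY]

theorem IsSelfAdjointFor.sub {X Y : Matrix (Fin n → ι) (Fin n → ι) R}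
    (hX : IsSelfAdjointFor ε X) (hY : IsSelfAdjointFor ε Y) : IsSelfAdjointFor ε (X - Y) := by
  rw [IsSelfAdjointFor] at *
  rw [mul_sub, Matrix.transpose_sub, sub_mul, hX, hY]

theorem IsSelfAdjointFor.smul {X : Matrix (Fin n → ι) (Fin n → ι) R}
    (hX : IsSelfAdjointFor ε X) (c : R) : IsSelfAdjointFor ε (c • X) := by
  rw [IsSelfAdjointFor] at *
  rw [mul_smul_comm, Matrix.transpose_smul, smul_mul_assoc, hX]

theorem IsSelfAdjointFor.one :
    IsSelfAdjointFor ε (1 : Matrix (Fin n → ι) (Fin n → ι) R) := by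
  rw [IsSelfAdjointFor, mul_one, Matrix.transpose_one, one_mul]

theorem IsSelfAdjointFor.zero :
    IsSelfAdjointFor ε (0 : Matrix (Fin n → ι) (Fin n → ι) R) := by
  rw [IsSelfAdjointFor, mul_zero, Matrix.transpose_zero, zero_mul]

/-- Taking the adjoint inverts the permutation, so an involution is needed. -/
theorem isSelfAdjointFor_permOp (hθ : ∀ a b, ε a * θ a b = ε b * θ b a)
    {π : Equiv.Perm (Fin n)} (hπ : π * π = 1) : IsSelfAdjointFor ε (permOp θ π) := by
  refine isSelfAdjointFor_iff.2 fun l i => ?_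
  have h : ∀ m, π (π m) = m := fun m => by rw [← Equiv.Perm.mul_apply, hπ, Equiv.Perm.one_apply]
  simp only [permOp, Matrix.of_apply]
  rw [← Equiv.prod_comp π fun m => ε (i m), ← Equiv.prod_comp π fun m => θ (i m) (l (π m)),
    ← Finset.prod_mul_distrib, ← Finset.prod_mul_distrib]
  exact Finset.prod_congr rfl fun m _ => by rw [h, hθ]

theorem isSelfAdjointFor_capOp (hθ : ∀ a b, ε a * θ a b = ε b * θ b a)
    (hε : ∀ a b, ε a * ε b * θcheck a b = θhat a b) {a b : Fin n} (hab : a ≠ b) :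
    IsSelfAdjointFor ε (capOp θ θhat θcheck a b) := by
  refine isSelfAdjointFor_iff.2 fun l i => ?_
  have h : ∀ l i : Fin n → ι, (∏ m, ε (l m)) * capOp θ θhat θcheck a b l i =
      θhat (l a) (l b) * θhat (i a) (i b) *
        ∏ m ∈ Finset.univ.filter (fun m => m ≠ a ∧ m ≠ b), ε (l m) * θ (l m) (i m) := by
    intro l i
    rw [prod_split hab, Finset.prod_mul_distrib, ← hε (l a)]
    simp only [capOp, Matrix.of_apply]
    ring
  rw [h, h, mul_comm (θhat (i a) (i b))]
  simp only [hθ]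

theorem isSelfAdjointFor_jucysMurphyOp (hθ : ∀ a b, ε a * θ a b = ε b * θ b a)
    (hε : ∀ a b, ε a * ε b * θcheck a b = θhat a b) (m : ℕ) :
    IsSelfAdjointFor ε (jucysMurphyOp n θ θhat θcheck m) := by
  rw [jucysMurphyOp]
  split_ifs with h
  · refine Finset.sum_induction _ (IsSelfAdjointFor ε) (fun _ _ => IsSelfAdjointFor.add)
      IsSelfAdjointFor.zero fun l hl => ?_
    exact (isSelfAdjointFor_permOp hθ (Equiv.swap_mul_self _ _)).sub
      (isSelfAdjointFor_capOp hθ hε (Finset.mem_Iio.1 hl).ne)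
  · exact IsSelfAdjointFor.zero

theorem commute_jucysMurphyOp_add_smul_harmonicOp (H : IsTriple θ θhat θcheck ω) (m i : ℕ) (c : R) :
    Commute (jucysMurphyOp n θ θhat θcheck m + c • 1) (harmonicOp n θ θhat θcheck ω i) := by
  have hc : ∀ (c : R) (Z : Matrix (Fin n → ι) (Fin n → ι) R), Commute (c • 1) Z := fun c Z =>
    (Commute.one_left Z).smul_left c
  refine Commute.add_left ?_ (hc c _)
  induction i with
  | zero => exact (commute_one_jucysMurphyOp H m).symm
  | succ i ih =>
    have h : ∀ c : R, Commute (jucysMurphyOp n θ θhat θcheck m)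
        (jucysMurphyOp n θ θhat θcheck (i + 1) + c • 1) := fun c =>
      (commute_jucysMurphyOp H m _).add_right (hc c _).symm
    exact (h _).mul_right ((h _).mul_right ih)

/-- All factors are self-adjoint, and they commute, so the order reversed by the adjoint does not
matter. -/
theorem isSelfAdjointFor_harmonicOp (H : IsTriple θ θhat θcheck ω)
    (hθ : ∀ a b, ε a * θ a b = ε b * θ b a)
    (hε : ∀ a b, ε a * ε b * θcheck a b = θhat a b) (i : ℕ) :
    IsSelfAdjointFor ε (harmonicOp n θ θhat θcheck ω i) := by
  induction i with
  | zero => exact isSelfAdjointFor_permOp hθ (mul_one 1)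
  | succ i ih =>
    have h : ∀ c : R, IsSelfAdjointFor ε (jucysMurphyOp n θ θhat θcheck (i + 1) + c • 1) :=
      fun c => (isSelfAdjointFor_jucysMurphyOp hθ hε _).add (IsSelfAdjointFor.one.smul c)
    have hc := fun c : R => commute_jucysMurphyOp_add_smul_harmonicOp (n := n) H (i + 1) i c
    refine (h _).mul ((h _).mul ih (hc _)) (Commute.mul_right ?_ (hc _))
    exact ((Commute.refl _).add_right ((Commute.one_right _).smul_right _)).add_left
      ((Commute.one_left _).smul_left _)

end SelfAdjoint

/-! ### Change of scalars, to descend from complex to real components. -/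

section Map

variable {ι R R' : Type} [CommRing R] [CommRing R'] {n : ℕ}
  (f : R →+* R') (θ θhat θcheck : Matrix ι ι R) (ω : R)

theorem permOp_map (π : Equiv.Perm (Fin n)) : (permOp θ π).map f = permOp (θ.map f) π := by
  ext l i
  simp [permOp]

theorem capOp_map (a b : Fin n) :
    (capOp θ θhat θcheck a b).map f = capOp (θ.map f) (θhat.map f) (θcheck.map f) a b := by
  ext l i
  simp [capOp]

theorem jucysMurphyOp_map [Fintype ι] (m : ℕ) : (jucysMurphyOp n θ θhat θcheck m).map f =
    jucysMurphyOp n (θ.map f) (θhat.map f) (θcheck.map f) m := by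
  rw [jucysMurphyOp, jucysMurphyOp]
  split_ifs with h
  · ext l i
    simp only [jmOp, flipSubCap, ← permOp_map, ← capOp_map, Matrix.map_apply, Matrix.sum_apply,
      Matrix.sub_apply, map_sum, map_sub]
  · ext l i
    simp

theorem harmonicOp_map [Fintype ι] [DecidableEq ι] (i : ℕ) :
    (harmonicOp n θ θhat θcheck ω i).map f =
    harmonicOp n (θ.map f) (θhat.map f) (θcheck.map f) (f ω) i := by
  induction i with
  | zero => exact permOp_map f θ 1
  | succ i ih =>
    have h : ∀ c : R, (jucysMurphyOp n θ θhat θcheck (i + 1) + c • 1).map f =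
        jucysMurphyOp n (θ.map f) (θhat.map f) (θcheck.map f) (i + 1) + f c • 1 := fun c => by
      rw [← jucysMurphyOp_map]
      ext l i
      simp [Matrix.one_apply, apply_ite f]
    rw [harmonicOp, Matrix.map_mul, Matrix.map_mul, h, h, ih, harmonicOp, map_one, map_sub,
      map_add, map_natCast, map_ofNat]

end Map

/-! ### Component formulas for operators acting on one or two slots. -/

section SumOverIndices

variable {ι R : Type} [Fintype ι] [CommRing R] {n : ℕ}
  {θ θhat θcheck : Matrix ι ι R} {ω : R}

theorem permOp_mulVec_apply (θ : Matrix ι ι R) (π : Equiv.Perm (Fin n)) (x : (Fin n → ι) → R)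
    (l : Fin n → ι) : (permOp θ π *ᵥ x) l = (permOp θ 1 *ᵥ x) (l ∘ π.symm) := by
  refine Finset.sum_congr rfl fun i _ => ?_
  congr 1
  simp only [permOp, Matrix.of_apply]
  rw [← Equiv.prod_comp π.symm]
  simp

variable [DecidableEq ι]

theorem sum_update_of_eq_zero {M : Type} [AddCommMonoid M] (f : (Fin n → ι) → M) (l : Fin n → ι)
    (a : Fin n) (h : ∀ i, (∃ m, m ≠ a ∧ l m ≠ i m) → f i = 0) :
    ∑ i, f i = ∑ t, f (Function.update l a t) := by
  symm
  refine Fintype.sum_of_injective (Function.update l a) (Function.update_injective l a) _ _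
    (fun i hi => h i ?_) fun _ => rfl
  by_contra! hc
  refine hi ⟨i a, funext fun m => ?_⟩
  by_cases hm : m = a
  · rw [hm, Function.update_self]
  · rw [Function.update_of_ne hm, hc m hm]

theorem sum_update_update_of_eq_zero {M : Type} [AddCommMonoid M] (f : (Fin n → ι) → M)
    (l : Fin n → ι) {a b : Fin n} (hab : a ≠ b)
    (h : ∀ i, (∃ m, m ≠ a ∧ m ≠ b ∧ l m ≠ i m) → f i = 0) :
    ∑ i, f i = ∑ s, ∑ t, f (Function.update (Function.update l a s) b t) := by
  rw [← Fintype.sum_prod_type']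
  symm
  refine Fintype.sum_of_injective
    (fun z : ι × ι => Function.update (Function.update l a z.1) b z.2) (fun z z' hz => ?_) _ _
    (fun i hi => h i ?_) fun _ => rfl
  · have h1 := congrFun hz a
    have h2 := congrFun hz b
    simp only [Function.update_self, Function.update_of_ne hab] at h1 h2
    exact Prod.ext h1 h2
  · by_contra! hc
    refine hi ⟨(i a, i b), funext fun m => ?_⟩
    by_cases hb : m = b
    · simp only [hb, Function.update_self]
    · by_cases ha : m = a
      · simp only [ha, Function.update_of_ne hab, Function.update_self]
      · simp only [Function.update_of_ne hb, Function.update_of_ne ha, hc m ha hb]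

/-- The operator acting by the matrix `A` in the slot `a`. -/
def slotOp (a : Fin n) (A : Matrix ι ι R) : Matrix (Fin n → ι) (Fin n → ι) R :=
  tens (Function.update (fun _ => 1) a A)

theorem slotOp_mulVec_apply (a : Fin n) (A : Matrix ι ι R) (x : (Fin n → ι) → R)
    (l : Fin n → ι) :
    (slotOp a A *ᵥ x) l = ∑ t, A (l a) t * x (Function.update l a t) := by
  refine (sum_update_of_eq_zero _ l a fun i hi => ?_).trans (Finset.sum_congr rfl fun t _ => ?_)
  · obtain ⟨m, hm, hl⟩ := hi
    simp only [slotOp, tens, Matrix.of_apply]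
    rw [Finset.prod_eq_zero (Finset.mem_univ m), zero_mul]
    rw [Function.update_of_ne hm, Matrix.one_apply_ne hl]
  · simp only [slotOp, tens, Matrix.of_apply]
    rw [← Finset.mul_prod_erase _ _ (Finset.mem_univ a), Finset.prod_eq_one, mul_one,
      Function.update_self, Function.update_self]
    intro m hm
    have := Finset.ne_of_mem_erase hm
    rw [Function.update_of_ne this, Function.update_of_ne this, Matrix.one_apply_eq]

theorem slotOp_mul_tens (a : Fin n) (A : Matrix ι ι R) (B : Fin n → Matrix ι ι R) :
    slotOp a A * tens B = tens (Function.update B a (A * B a)) := by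
  rw [slotOp, tens_mul]
  congr 1
  funext m
  by_cases h : m = a
  · subst h
    rw [Function.update_self, Function.update_self]
  · rw [Function.update_of_ne h, Function.update_of_ne h, one_mul]

/-- `θ^{⊗n}` is the product of the one-slot operators, each of which it absorbs by idempotence. -/
theorem permOp_one_mulVec_eq_iff (h : θ * θ = θ) (x : (Fin n → ι) → R) :
    permOp θ 1 *ᵥ x = x ↔ ∀ a, slotOp a θ *ᵥ x = x := by
  refine ⟨fun hx a => ?_, fun hx => ?_⟩
  · rw [← hx, Matrix.mulVec_mulVec, permOp_one, slotOp_mul_tens, h, Function.update_eq_self]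
  · have hS : ∀ S : Finset (Fin n), tens (fun m => if m ∈ S then θ else 1) *ᵥ x = x := fun S => by
      induction S using Finset.induction_on with
      | empty =>
        have : tens (fun _ : Fin n => (1 : Matrix ι ι R)) = 1 := by
          ext l i
          simp only [tens, Matrix.of_apply, Matrix.one_apply, Finset.prod_ite_zero,
            Finset.prod_const_one, Finset.mem_univ, true_implies, funext_iff]
        simp only [Finset.notMem_empty, if_false, this, Matrix.one_mulVec]
      | insert a S ha ih =>
        have e : tens (fun m => if m ∈ insert a S then θ else 1) =
            slotOp a θ * tens fun m => if m ∈ S then θ else 1 := by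
          rw [slotOp_mul_tens, if_neg ha, mul_one]
          congr 1
          funext m
          by_cases hm : m = a
          · subst hm
            rw [Function.update_self, if_pos (Finset.mem_insert_self _ _)]
          · rw [Function.update_of_ne hm]
            simp only [Finset.mem_insert, hm, false_or]
        rw [e, ← Matrix.mulVec_mulVec, ih, hx]
    simpa [permOp_one] using hS Finset.univ

theorem capOp_mulVec_apply (H : IsTriple θ θhat θcheck ω) {a b : Fin n} (hab : a ≠ b)
    {x : (Fin n → ι) → R} (hx : ∀ a, slotOp a θ *ᵥ x = x) (l : Fin n → ι) :
    (capOp θ θhat θcheck a b *ᵥ x) l = θcheck (l a) (l b) *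
      ∑ s, ∑ t, θhat s t * x (Function.update (Function.update l a s) b t) := by
  -- With the identity in place of `θ` in the untouched slots, only two indices are summed. The true
  -- cap is this bare cap times `θ^{⊗n}`, which fixes `x`.
  have hbare : ∀ (x : (Fin n → ι) → R) (l : Fin n → ι),
      (capOp 1 θhat θcheck a b *ᵥ x) l = θcheck (l a) (l b) *
      ∑ s, ∑ t, θhat s t * x (Function.update (Function.update l a s) b t) := fun x l => by
    rw [Finset.mul_sum]
    simp only [Finset.mul_sum]
    refine (sum_update_update_of_eq_zero _ l hab fun i hi => ?_).trans
      (Finset.sum_congr rfl fun s _ => Finset.sum_congr rfl fun t _ => ?_)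
    · obtain ⟨m, hma, hmb, hl⟩ := hi
      simp only [capOp, Matrix.of_apply]
      have h0 : ∏ m ∈ Finset.univ.filter (fun m => m ≠ a ∧ m ≠ b),
          (1 : Matrix ι ι R) (l m) (i m) = 0 :=
        Finset.prod_eq_zero (Finset.mem_filter.2 ⟨Finset.mem_univ m, hma, hmb⟩)
          (Matrix.one_apply_ne hl)
      rw [h0, mul_zero, zero_mul]
    · simp only [capOp, Matrix.of_apply]
      rw [Finset.prod_eq_one, Function.update_self, Function.update_of_ne hab,
        Function.update_self]
      · ring
      · intro m hm
        obtain ⟨-, hma, hmb⟩ := Finset.mem_filter.1 hm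
        rw [Function.update_of_ne hmb, Function.update_of_ne hma, Matrix.one_apply_eq]
  have e : capOp 1 θhat θcheck a b * permOp θ 1 = capOp θ θhat θcheck a b := by
    ext l r
    refine (hbare (fun i => permOp θ 1 i r) l).trans ?_
    set P := ∏ m ∈ Finset.univ.filter (fun m => m ≠ a ∧ m ≠ b), θ (l m) (r m) with hP
    have h1 : ∀ s t, permOp θ 1 (Function.update (Function.update l a s) b t) r =
        θ s (r a) * θ t (r b) * P := fun s t => by
      simp only [permOp, Matrix.of_apply, Equiv.Perm.one_apply]
      rw [prod_split hab, Function.update_self, Function.update_of_ne hab, Function.update_self, hP]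
      congr 1
      refine Finset.prod_congr rfl fun m hm => ?_
      obtain ⟨-, hma, hmb⟩ := Finset.mem_filter.1 hm
      rw [Function.update_of_ne hmb, Function.update_of_ne hma]
    have h2 : ∀ s u, ∑ t, θhat s t * θ t u = θhat s u := fun s u => by
      rw [← Matrix.mul_apply, H.hat_mul]
    have hs : ∀ u v, θhat u v = θhat v u := fun u v => congrFun (congrFun H.hat_symm.symm u) v
    have h3 : ∑ s, ∑ t, θhat s t * (θ s (r a) * θ t (r b) * P) = θhat (r a) (r b) * P := by
      have : ∀ s, ∑ t, θhat s t * (θ s (r a) * θ t (r b) * P) =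
          θhat (r b) s * θ s (r a) * P := fun s => by
        rw [hs (r b), ← h2, Finset.sum_mul, Finset.sum_mul]
        exact Finset.sum_congr rfl fun t _ => by ring
      simp only [this]
      rw [← Finset.sum_mul, h2, hs]
    simp only [h1]
    rw [h3, ← mul_assoc]
    rfl
  rw [← hbare, ← e, ← Matrix.mulVec_mulVec, (permOp_one_mulVec_eq_iff H.idem x).2 hx]

end SumOverIndices

/-! ### Harmonic tensors for `Θ(k)` are the symmetric, transverse, traceless ones. -/

section Components

variable {p q j : ℕ} {k : Idx p q → ℝ}

theorem toComplex_injective {α β : Type} : Function.Injective (toComplex : Matrix α β ℝ → _) :=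
  fun _ _ h => Matrix.map_injective Complex.ofReal_injective h

theorem toComplex_mul {α : Type} [Fintype α] (A B : Matrix α α ℝ) :
    toComplex (A * B) = toComplex A * toComplex B :=
  Matrix.map_mul (f := Complex.ofRealHom)

theorem Theta_isTriple_real (hk : sq k ≠ 0) :
    IsTriple (Theta k) (ThetaHat k) (ThetaCheck k) ((p : ℝ) + q - 1) := by
  have H := Theta_isTriple hk
  refine ⟨Theta_idem hk, ?_, ?_, ?_, ?_, ?_, Theta_trace hk⟩ <;> apply toComplex_injective
  · rw [toComplex_mul, H.check_hat]
  · rw [toComplex_mul, H.mul_check]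
  · rw [toComplex_mul, H.hat_mul]
  · exact H.check_symm
  · exact H.hat_symm

/-- Tensors that are transverse in all slots, and symmetric and traceless in the slots of `S`. -/
structure IsSymmetricTTOn (k : Idx p q → ℝ) (S : Finset (Fin j)) (x : (Fin j → Idx p q) → ℝ) :
    Prop where
  symm : ∀ a ∈ S, ∀ b ∈ S, ∀ n, x (n ∘ Equiv.swap a b) = x n
  transverse : ∀ (a : Fin j) n, ∑ t, lower k t * x (Function.update n a t) = 0
  traceless : ∀ a ∈ S, ∀ b ∈ S, a ≠ b → ∀ n,
    ∑ t, eta p q t * x (Function.update (Function.update n a t) b t) = 0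

theorem isSymmetricTTOn_univ {x : (Fin j → Idx p q) → ℝ} :
    IsSymmetricTTOn k Finset.univ x ↔ IsSymmetricTT k x :=
  ⟨fun h => ⟨fun a b => h.symm a (Finset.mem_univ _) b (Finset.mem_univ _), h.transverse,
    fun a b => h.traceless a (Finset.mem_univ _) b (Finset.mem_univ _)⟩,
    fun h => ⟨fun a _ b _ => h.symm a b, h.transverse, fun a _ b _ => h.traceless a b⟩⟩

theorem sum_Theta_mul (k : Idx p q → ℝ) (f : Idx p q → ℝ) (n : Idx p q) :
    ∑ t, Theta k n t * f t = f n - k n / sq k * ∑ t, lower k t * f t := by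
  simp only [Theta, Matrix.of_apply, sub_mul, Finset.sum_sub_distrib, ite_mul, one_mul, zero_mul,
    Finset.sum_ite_eq, Finset.mem_univ, if_true]
  rw [Finset.mul_sum]
  congr 1
  exact Finset.sum_congr rfl fun t _ => by ring

theorem slotOp_Theta_mulVec {x : (Fin j → Idx p q) → ℝ} {a : Fin j}
    (hx : ∀ n, ∑ t, lower k t * x (Function.update n a t) = 0) :
    slotOp a (Theta k) *ᵥ x = x := by
  funext n
  rw [slotOp_mulVec_apply, sum_Theta_mul, hx, mul_zero, sub_zero, Function.update_eq_self]

/-- Invariance under `Θ` says that `k^c / k^2` times the contraction vanishes for every `c`, and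
some component `k^c` is nonzero. -/
theorem sum_lower_mul_of_slotOp_Theta_mulVec (hk : sq k ≠ 0) {x : (Fin j → Idx p q) → ℝ}
    {a : Fin j} (hx : slotOp a (Theta k) *ᵥ x = x) (n : Fin j → Idx p q) :
    ∑ t, lower k t * x (Function.update n a t) = 0 := by
  obtain ⟨c, hc⟩ : ∃ c, k c ≠ 0 := by
    by_contra! h
    exact hk (by simp [sq, h])
  have h := congrFun hx (Function.update n a c)
  rw [slotOp_mulVec_apply, sum_Theta_mul] at h
  simp only [Function.update_idem, Function.update_self] at h
  have h' : k c / sq k * ∑ t, lower k t * x (Function.update n a t) = 0 := by linarith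
  exact (mul_eq_zero.1 h').resolve_left (div_ne_zero hc hk)

theorem ThetaHat_apply (k : Idx p q → ℝ) (s t : Idx p q) :
    ThetaHat k s t = eta p q t * Theta k t s := by
  rw [ThetaHat, Matrix.mul_diagonal, Matrix.transpose_apply, mul_comm]

theorem ThetaCheck_apply (k : Idx p q → ℝ) (s t : Idx p q) :
    ThetaCheck k s t = Theta k s t * eta p q t := by
  rw [ThetaCheck, Matrix.mul_diagonal]

/-- The trace of `Θ` is `D - 1 > 0`. For `D = 1` one has `Θ = 0`, and the vanishing of a cap would
say nothing about the trace. -/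
theorem exists_ThetaCheck_ne_zero (hD : 2 ≤ p + q) (hk : sq k ≠ 0) :
    ∃ s t, ThetaCheck k s t ≠ 0 := by
  by_contra! h
  have h0 : Theta k = 0 := by
    ext s t
    have h1 := h s t
    rw [ThetaCheck_apply] at h1
    have h2 := eta_mul_eta (p := p) (q := q) t
    exact (mul_eq_zero.1 h1).resolve_right fun h3 => by simp [h3] at h2
  have h3 := Theta_trace hk
  rw [h0, Matrix.trace_zero] at h3
  have : (2 : ℝ) ≤ (p : ℝ) + q := by exact_mod_cast hD
  linarith

/-- By transversality the `Θ` inside `Θhat` acts as the identity, which leaves the trace with `η`.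
-/
theorem capOp_Theta_mulVec_apply (hk : sq k ≠ 0) {x : (Fin j → Idx p q) → ℝ}
    (hx : ∀ a n, ∑ t, lower k t * x (Function.update n a t) = 0) {a b : Fin j} (hab : a ≠ b)
    (n : Fin j → Idx p q) :
    (capOp (Theta k) (ThetaHat k) (ThetaCheck k) a b *ᵥ x) n = ThetaCheck k (n a) (n b) *
      ∑ t, eta p q t * x (Function.update (Function.update n a t) b t) := by
  rw [capOp_mulVec_apply (Theta_isTriple_real hk) hab fun a => slotOp_Theta_mulVec (hx a)]
  congr 1
  rw [Finset.sum_comm]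
  refine Finset.sum_congr rfl fun t _ => ?_
  have h := hx a (Function.update n b t)
  simp only [ThetaHat_apply, mul_assoc]
  rw [← Finset.mul_sum, sum_Theta_mul]
  simp only [Function.update_comm hab]
  rw [h, mul_zero, sub_zero]

theorem isHarmonicOn_iff (hD : 2 ≤ p + q) (hk : sq k ≠ 0) {S : Finset (Fin j)}
    {x : (Fin j → Idx p q) → ℝ} :
    IsHarmonicOn (Theta k) (ThetaHat k) (ThetaCheck k) S x ↔ IsSymmetricTTOn k S x := by
  have hQ : permOp (Theta k) 1 *ᵥ x = x ↔
      ∀ a n, ∑ t, lower k t * x (Function.update n a t) = 0 :=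
    (permOp_one_mulVec_eq_iff (Theta_idem hk) x).trans (forall_congr' fun a =>
      ⟨fun h => sum_lower_mul_of_slotOp_Theta_mulVec hk h, fun h => slotOp_Theta_mulVec h⟩)
  have hs : permOp (Theta k) 1 *ᵥ x = x → ∀ (a b : Fin j) n,
      (permOp (Theta k) (Equiv.swap a b) *ᵥ x) n = x (n ∘ Equiv.swap a b) := fun h a b n => by
    rw [permOp_mulVec_apply, h, Equiv.symm_swap]
  constructor
  · intro h
    have ht := hQ.1 h.proj
    refine ⟨fun a ha b hb n => ?_, ht, fun a ha b hb hab n => ?_⟩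
    · rw [← hs h.proj, h.swap a ha b hb]
    -- The trace does not depend on the indices in slots `a` and `b`, so they can be set to values
    -- at which the prefactor `Θcheck` is nonzero.
    · obtain ⟨s, t, hst⟩ := exists_ThetaCheck_ne_zero hD hk
      have h1 := congrFun (h.cap a ha b hb hab) (Function.update (Function.update n a s) b t)
      rw [capOp_Theta_mulVec_apply hk ht hab, Function.update_of_ne hab, Function.update_self,
        Function.update_self, Pi.zero_apply] at h1
      have h2 := (mul_eq_zero.1 h1).resolve_left hst
      have h3 : ∀ c, Function.update (Function.update (Function.update (Function.update n a s) b t)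
          a c) b c = Function.update (Function.update n a c) b c := fun c => by
        rw [Function.update_comm hab, Function.update_idem, Function.update_comm hab.symm,
          Function.update_idem]
      simpa only [h3] using h2
  · intro h
    have hp := hQ.2 h.transverse
    refine ⟨hp, fun a ha b hb => ?_, fun a ha b hb hab => ?_⟩
    · funext n
      rw [hs hp, h.symm a ha b hb]
    · funext n
      rw [capOp_Theta_mulVec_apply hk h.transverse hab, h.traceless a ha b hb hab, mul_zero,
        Pi.zero_apply]

end Components

/-! ### The projector: image, self-adjointness, uniqueness. -/

section SpinProjector

variable {p q : ℕ} {k : Idx p q → ℝ}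

/-- The real matrix of the image of the complete symmetrizer. -/
noncomputable def spinProjector (j : ℕ) (k : Idx p q → ℝ) :
    Matrix (Fin j → Idx p q) (Fin j → Idx p q) ℝ :=
  ((j.factorial : ℝ) * ∏ m ∈ Finset.Icc 2 j, ((p : ℝ) + q - 1 + 2 * (m : ℝ) - 4))⁻¹ •
    harmonicOp j (Theta k) (ThetaHat k) (ThetaCheck k) ((p : ℝ) + q - 1) (j - 1)

theorem symmetrizerImage_eq {j : ℕ} (hj : 1 ≤ j) (hk : sq k ≠ 0) :
    symmetrizerImage j k hk = toComplex (spinProjector j k) := by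
  have h := harmonicOp_map (n := j) Complex.ofRealHom (Theta k) (ThetaHat k) (ThetaCheck k)
    ((p : ℝ) + q - 1) (j - 1)
  have hω : Complex.ofRealHom ((p : ℝ) + q - 1) = (p : ℂ) + q - 1 := by simp
  rw [hω] at h
  rw [symmetrizerImage, momentumRep, tensorRep_symmetrizer _ hj]
  change _ • harmonicOp j ((Theta k).map Complex.ofRealHom) ((ThetaHat k).map Complex.ofRealHom)
    ((ThetaCheck k).map Complex.ofRealHom) _ _ = _
  rw [← h, spinProjector]
  ext n r
  simp [toComplex]

theorem isSymmetricTT_spinProjector_mulVec {j : ℕ} (hD : 2 ≤ p + q) (hj : 1 ≤ j) (hk : sq k ≠ 0)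
    (x : (Fin j → Idx p q) → ℝ) : IsSymmetricTT k (spinProjector j k *ᵥ x) := by
  have h := (isHarmonicOn_harmonicOp_mulVec (Theta_isTriple_real hk) x (j - 1)
    (Nat.sub_lt hj one_pos)).smul
      (((j.factorial : ℝ) * ∏ m ∈ Finset.Icc 2 j, ((p : ℝ) + q - 1 + 2 * (m : ℝ) - 4))⁻¹)
  have e : Finset.Iic (⟨j - 1, Nat.sub_lt hj one_pos⟩ : Fin j) = Finset.univ := by
    ext a
    have := a.2
    simp only [Finset.mem_Iic, Fin.le_def, Finset.mem_univ, iff_true]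
    omega
  rw [e, ← Matrix.smul_mulVec] at h
  exact isSymmetricTTOn_univ.1 ((isHarmonicOn_iff hD hk).1 h)

theorem spinProjector_mulVec {j : ℕ} (hD : 2 ≤ p + q) (hj : 1 ≤ j) (hk : sq k ≠ 0)
    {x : (Fin j → Idx p q) → ℝ} (hx : IsSymmetricTT k x) : spinProjector j k *ᵥ x = x := by
  have hx' := (isHarmonicOn_iff hD hk).2 (isSymmetricTTOn_univ.2 hx)
  have h := harmonicOp_mulVec_of_isHarmonicOn (ω := (p : ℝ) + q - 1) hx' (j - 1)
    (Nat.sub_lt hj one_pos)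
  rw [Nat.sub_add_cancel hj] at h
  rw [spinProjector, Matrix.smul_mulVec, h, smul_smul, inv_mul_cancel₀, one_smul]
  -- The normalization is nonzero since `D + 2m - 5 ≥ 1` for `D, m ≥ 2`.
  have hD' : (2 : ℝ) ≤ (p : ℝ) + q := by exact_mod_cast hD
  refine mul_ne_zero (by exact_mod_cast j.factorial_ne_zero) (Finset.prod_ne_zero_iff.2 ?_)
  intro m hm
  have : (2 : ℝ) ≤ m := by exact_mod_cast (Finset.mem_Icc.1 hm).1
  have : 0 < (p : ℝ) + q - 1 + 2 * (m : ℝ) - 4 := by linarith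
  exact this.ne'

theorem eta_mul_Theta (k : Idx p q → ℝ) (a b : Idx p q) :
    eta p q a * Theta k a b = eta p q b * Theta k b a := by
  have h := congrFun (congrFun (diag_mul_Theta k) a) b
  rwa [Matrix.diagonal_mul, Matrix.mul_diagonal, Matrix.transpose_apply,
    mul_comm (Theta k b a)] at h

theorem eta_mul_eta_mul_ThetaCheck (k : Idx p q → ℝ) (a b : Idx p q) :
    eta p q a * eta p q b * ThetaCheck k a b = ThetaHat k a b := by
  rw [ThetaCheck_apply, ThetaHat_apply]
  linear_combination (eta p q a * Theta k a b) * eta_mul_eta b + eta_mul_Theta k a b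

/-- Take adjoints of `Y T = c T`; the form can be cancelled because the product of the signs `η`
squares to one. This converts absorption on the left into absorption on the right. -/
theorem IsSelfAdjointFor.mul_eq_smul {n : ℕ} {T Y : Matrix (Fin n → Idx p q) (Fin n → Idx p q) ℝ}
    (hT : IsSelfAdjointFor (eta p q) T) (hY : IsSelfAdjointFor (eta p q) Y) {c : ℝ}
    (h : Y * T = c • T) : T * Y = c • T := by
  have h4 : Matrix.diagonal (fun l : Fin n → Idx p q => ∏ m, eta p q (l m)) *
      Matrix.diagonal (fun l => ∏ m, eta p q (l m)) = 1 := by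
    rw [Matrix.diagonal_mul_diagonal]
    simp only [← Finset.prod_mul_distrib, eta_mul_eta, Finset.prod_const_one, Matrix.diagonal_one]
  have h5 : Matrix.diagonal (fun l : Fin n → Idx p q => ∏ m, eta p q (l m)) * (T * Y) =
      Matrix.diagonal (fun l : Fin n → Idx p q => ∏ m, eta p q (l m)) * (c • T) := by
    rw [IsSelfAdjointFor] at hT hY
    rw [← mul_assoc, hT, mul_assoc, hY, ← mul_assoc, ← Matrix.transpose_mul, h,
      Matrix.transpose_smul, smul_mul_assoc, ← hT, mul_smul_comm]
  rw [← one_mul (T * Y), ← h4, mul_assoc, h5, ← mul_assoc, h4, one_mul]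

theorem spinProjector_hermitian {j : ℕ} (hk : sq k ≠ 0) :
    IsSelfAdjointFor (eta p q) (spinProjector j k) :=
  (isSelfAdjointFor_harmonicOp (Theta_isTriple_real hk) (eta_mul_Theta k)
    (eta_mul_eta_mul_ThetaCheck k) _).smul _

theorem mulVec_single_eq {α : Type} [Fintype α] [DecidableEq α] (T : Matrix α α ℝ) (r : α) :
    T *ᵥ Pi.single r 1 = fun n => T n r := by
  rw [Matrix.mulVec_single_one]
  rfl

/-- The columns of `T` lie in its image, which settles the upper indices; self-adjointness exchanges
rows and columns up to signs and so settles the lower ones. -/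
theorem IsBehrendsFronsdal.of_hermitian {j : ℕ} {T : Matrix (Fin j → Idx p q) (Fin j → Idx p q) ℝ}
    (hT : IsSelfAdjointFor (eta p q) T) (h1 : ∀ x, IsSymmetricTT k (T *ᵥ x))
    (h2 : ∀ x, IsSymmetricTT k x → T *ᵥ x = x) : IsBehrendsFronsdal k T := by
  have hc : ∀ r, IsSymmetricTT k fun n => T n r := fun r => by
    rw [← mulVec_single_eq]
    exact h1 _
  have hherm := isSelfAdjointFor_iff.1 hT
  have hne : ∀ n : Fin j → Idx p q, (∏ m, eta p q (n m)) * ∏ m, eta p q (n m) = 1 := fun n => by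
    rw [← Finset.prod_mul_distrib, Finset.prod_eq_one fun m _ => eta_mul_eta (n m)]
  have hT' : ∀ n r, T n r = (∏ m, eta p q (n m)) * ((∏ m, eta p q (r m)) * T r n) := fun n r => by
    rw [← hherm, ← mul_assoc, hne, one_mul]
  have hupd : ∀ (r : Fin j → Idx p q) (a : Fin j) x,
      ∏ m, eta p q (Function.update r a x m) =
        eta p q x * ∏ m ∈ Finset.univ.erase a, eta p q (r m) := fun r a x => by
    rw [← Finset.mul_prod_erase _ _ (Finset.mem_univ a), Function.update_self]
    congr 1
    exact Finset.prod_congr rfl fun m hm => by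
      rw [Function.update_of_ne (Finset.ne_of_mem_erase hm)]
  refine ⟨?_, hherm, fun a b n r => ?_, fun a b n r => (hc r).symm a b n, fun a n r => ?_,
    fun a n r => (hc r).transverse a n, fun a b hab n r => ?_,
    fun a b hab n r => (hc r).traceless a b hab n⟩
  · ext n r
    exact congrFun (h2 _ (hc r)) n
  · rw [hT' n, hT' n r, (hc n).symm a b r]
    congr 2
    exact Equiv.prod_comp (Equiv.swap a b) fun m => eta p q (r m)
  · have h := (hc n).transverse a r
    -- The sign `η` of the summed index turns `k^x` into `k_x`.
    have e : ∀ x, k x * T n (Function.update r a x) = ((∏ m, eta p q (n m)) *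
        ∏ m ∈ Finset.univ.erase a, eta p q (r m)) *
          (lower k x * T (Function.update r a x) n) := fun x => by
      rw [hT' n, hupd, lower]
      ring
    simp only [e]
    rw [← Finset.mul_sum, h, mul_zero]
  · have h := (hc n).traceless a b hab r
    -- The summed index occupies two slots, so its two signs cancel.
    have e : ∀ x, eta p q x * T n (Function.update (Function.update r a x) b x) =
        ((∏ m, eta p q (n m)) *
          ∏ m ∈ (Finset.univ.erase b).erase a, eta p q (r m)) *
          (eta p q x * T (Function.update (Function.update r a x) b x) n) := fun x => by
      have h3 : ∏ m ∈ Finset.univ.erase b, eta p q (Function.update r a x m) =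
          eta p q x * ∏ m ∈ (Finset.univ.erase b).erase a, eta p q (r m) := by
        rw [← Finset.mul_prod_erase _ _ (Finset.mem_erase.2 ⟨hab, Finset.mem_univ a⟩),
          Function.update_self]
        congr 1
        exact Finset.prod_congr rfl fun m hm => by
          rw [Function.update_of_ne (Finset.ne_of_mem_erase hm)]
      rw [hT' n, hupd, h3]
      linear_combination ((∏ m, eta p q (n m)) *
        (∏ m ∈ (Finset.univ.erase b).erase a, eta p q (r m)) * eta p q x *
          T (Function.update (Function.update r a x) b x) n) * eta_mul_eta x
    simp only [e]
    rw [← Finset.mul_sum, h, mul_zero]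

theorem spinProjector_isBehrendsFronsdal {j : ℕ} (hD : 2 ≤ p + q) (hj : 1 ≤ j) (hk : sq k ≠ 0) :
    IsBehrendsFronsdal k (spinProjector j k) :=
  .of_hermitian (spinProjector_hermitian hk) (isSymmetricTT_spinProjector_mulVec hD hj hk)
    fun _ => spinProjector_mulVec hD hj hk

theorem spinProjector_isOntoSymmetricTT {j : ℕ} (hD : 2 ≤ p + q) (hj : 1 ≤ j) (hk : sq k ≠ 0) :
    IsOntoSymmetricTT k (spinProjector j k) := by
  ext x
  refine ⟨?_, fun hx => ⟨x, spinProjector_mulVec hD hj hk hx⟩⟩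
  rintro ⟨y, rfl⟩
  exact isSymmetricTT_spinProjector_mulVec hD hj hk y

/-- The columns of `T'` lie in the image of the idempotent `T`, on which `T` is the identity. -/
theorem IsBehrendsFronsdal.mul_eq_of_isOnto {j : ℕ}
    {T T' : Matrix (Fin j → Idx p q) (Fin j → Idx p q) ℝ} (hT : IsBehrendsFronsdal k T)
    (h : IsOntoSymmetricTT k T) (h' : IsOntoSymmetricTT k T') : T * T' = T' := by
  ext n r
  have h1 : T' *ᵥ Pi.single r 1 ∈ Set.range T.mulVec := by
    rw [h, ← h']
    exact ⟨_, rfl⟩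
  obtain ⟨y, hy⟩ := h1
  have h2 : T *ᵥ (T' *ᵥ Pi.single r 1) = T' *ᵥ Pi.single r 1 := by
    rw [← hy, Matrix.mulVec_mulVec, hT.idem]
  rw [mulVec_single_eq] at h2
  exact congrFun h2 n

theorem IsBehrendsFronsdal.eq_of_isOnto {j : ℕ}
    {T T' : Matrix (Fin j → Idx p q) (Fin j → Idx p q) ℝ} (hT : IsBehrendsFronsdal k T)
    (hT' : IsBehrendsFronsdal k T') (h : IsOntoSymmetricTT k T) (h' : IsOntoSymmetricTT k T') :
    T = T' := by
  have h1 := hT.mul_eq_of_isOnto h h'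
  have h2 := hT'.mul_eq_of_isOnto h' h
  have s1 : IsSelfAdjointFor (eta p q) T := isSelfAdjointFor_iff.2 hT.hermitian
  have s2 : IsSelfAdjointFor (eta p q) T' := isSelfAdjointFor_iff.2 hT'.hermitian
  -- The adjoint of `T T' = T'` is `T' T = T'`, while equality of images also gives `T' T = T`.
  have h3 := s2.mul_eq_smul s1 (h1.trans (one_smul ℝ T').symm)
  rw [← h2, h3, one_smul]

end SpinProjector

/-! ### The recursion for the explicit coefficients. -/

section Coefficients

theorem bfCoeff_zero (D j : ℕ) : bfCoeff D j 0 = 1 := by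
  have : (j.factorial : ℝ) ≠ 0 := by exact_mod_cast j.factorial_ne_zero
  simp [bfCoeff, this]

theorem prod_Icc_one_eq_prod_range (f : ℕ → ℝ) (A : ℕ) :
    ∏ B ∈ Finset.Icc 1 A, f B = ∏ B ∈ Finset.range A, f (B + 1) := by
  have h : Finset.Icc 1 A = Finset.Ico 1 (A + 1) := by
    ext B
    simp only [Finset.mem_Icc, Finset.mem_Ico]
    omega
  rw [h, Finset.prod_Ico_eq_prod_range, Nat.add_sub_cancel]
  simp only [add_comm]

theorem mul_bfCoeff_succ_succ {D n A : ℕ} (hA : 2 * A + 1 ≤ n)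
    (hN : (D : ℝ) + 2 * n - 3 ≠ 0) :
    ((D : ℝ) + 2 * n - 3) * bfCoeff D (n + 1) (A + 1) =
      -(bfCoeff D n A * ((n : ℝ) - 2 * A) * (n + 1) / (2 * (A + 1))) := by
  obtain ⟨m, rfl⟩ := Nat.exists_eq_add_of_le hA
  -- Raising both the rank and `B` by one leaves a factor unchanged, so the only new factor is the
  -- one at `B = 1`, which is `D + 2n - 3`.
  have hprod : ∏ B ∈ Finset.Icc 1 (A + 1),
      (2 * ((2 * A + 1 + m + 1 : ℕ) : ℝ) + (D : ℝ) - 2 * (B : ℝ) - 3) =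
      (∏ B ∈ Finset.Icc 1 A,
        (2 * ((2 * A + 1 + m : ℕ) : ℝ) + (D : ℝ) - 2 * (B : ℝ) - 3)) *
        ((D : ℝ) + 2 * (2 * A + 1 + m : ℕ) - 3) := by
    rw [prod_Icc_one_eq_prod_range, prod_Icc_one_eq_prod_range, Finset.prod_range_succ']
    congr 1
    · refine Finset.prod_congr rfl fun B _ => ?_
      push_cast
      ring
    · push_cast
      ring
  have hm : (m.factorial : ℝ) ≠ 0 := by exact_mod_cast m.factorial_ne_zero
  have hAf : (A.factorial : ℝ) ≠ 0 := by exact_mod_cast A.factorial_ne_zero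
  rw [bfCoeff, bfCoeff, hprod, show 2 * A + 1 + m + 1 - 2 * (A + 1) = m by omega,
    show 2 * A + 1 + m - 2 * A = m + 1 by omega, Nat.factorial_succ (2 * A + 1 + m),
    Nat.factorial_succ m, Nat.factorial_succ A]
  generalize hP : ∏ B ∈ Finset.Icc 1 A,
        (2 * ((2 * A + 1 + m : ℕ) : ℝ) + (D : ℝ) - 2 * (B : ℝ) - 3) = P
  -- If the common denominator vanishes, both coefficients are `0` by the convention for division by
  -- zero.
  by_cases hP0 : P = 0
  · simp [hP0]
  · have : (m : ℝ) + 1 ≠ 0 := by positivity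
    have : (A : ℝ) + 1 ≠ 0 := by positivity
    push_cast at hN ⊢
    field_simp
    ring

theorem mul_bfCoeff_succ {D n A : ℕ} (hA : 2 * A + 2 ≤ n)
    (hN : (D : ℝ) + 2 * n - 2 * A - 5 ≠ 0) :
    ((D : ℝ) + 2 * n - 2 * A - 5) * bfCoeff D n (A + 1) =
      -(bfCoeff D n A * ((n : ℝ) - 2 * A) * (n - 2 * A - 1) / (2 * (A + 1))) := by
  obtain ⟨m, rfl⟩ := Nat.exists_eq_add_of_le hA
  -- At fixed rank the new factor is the last one, at `B = A + 1`.
  have hprod : ∏ B ∈ Finset.Icc 1 (A + 1),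
      (2 * ((2 * A + 2 + m : ℕ) : ℝ) + (D : ℝ) - 2 * (B : ℝ) - 3) =
      (∏ B ∈ Finset.Icc 1 A,
        (2 * ((2 * A + 2 + m : ℕ) : ℝ) + (D : ℝ) - 2 * (B : ℝ) - 3)) *
        ((D : ℝ) + 2 * (2 * A + 2 + m : ℕ) - 2 * A - 5) := by
    rw [prod_Icc_one_eq_prod_range, prod_Icc_one_eq_prod_range, Finset.prod_range_succ]
    congr 1
    push_cast
    ring
  have hm : (m.factorial : ℝ) ≠ 0 := by exact_mod_cast m.factorial_ne_zero
  have hAf : (A.factorial : ℝ) ≠ 0 := by exact_mod_cast A.factorial_ne_zero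
  rw [bfCoeff, bfCoeff, hprod, show 2 * A + 2 + m - 2 * (A + 1) = m by omega,
    show 2 * A + 2 + m - 2 * A = m + 1 + 1 by omega, Nat.factorial_succ (m + 1),
    Nat.factorial_succ m, Nat.factorial_succ A]
  generalize hP : ∏ B ∈ Finset.Icc 1 A,
        (2 * ((2 * A + 2 + m : ℕ) : ℝ) + (D : ℝ) - 2 * (B : ℝ) - 3) = P
  generalize (D : ℝ) + 2 * ((2 * A + 2 + m : ℕ) : ℝ) - 2 * A - 5 = Q at hN ⊢
  by_cases hP0 : P = 0
  · simp [hP0]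
  · have : (m : ℝ) + 1 ≠ 0 := by positivity
    have : (m : ℝ) + 1 + 1 ≠ 0 := by positivity
    have : (A : ℝ) + 1 ≠ 0 := by positivity
    push_cast
    field_simp
    ring

/-- The recursion satisfied by the polynomials `∑_A a_A^{(n)} (r z)^A s^{n-2A}`. -/
theorem sum_bfCoeff_succ {D n : ℕ} (hD : 2 ≤ D) (hn : 1 ≤ n) (r z s : ℝ) :
    ((D : ℝ) + 2 * n - 3) * ∑ A ∈ Finset.range ((n + 1) / 2 + 1), bfCoeff D (n + 1) A *
        (r * z) ^ A * s ^ (n + 1 - 2 * A) =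
      ((D : ℝ) + 2 * n - 3) * s *
          (∑ A ∈ Finset.range (n / 2 + 1), bfCoeff D n A * (r * z) ^ A * s ^ (n - 2 * A)) -
        r * ∑ A ∈ Finset.range (n / 2 + 1), bfCoeff D n A *
          (A * (r * z) ^ (A - 1) * (2 * s * z) * s ^ (n - 2 * A) +
            (r * z) ^ A * ((n - 2 * A : ℕ) * s ^ (n - 2 * A - 1) * z)) := by
  have hD' : (2 : ℝ) ≤ D := by exact_mod_cast hD
  have hn' : (1 : ℝ) ≤ n := by exact_mod_cast hn
  set N := (D : ℝ) + 2 * n - 3 with hN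
  have hN0 : N ≠ 0 := by
    have : 0 < N := by rw [hN]; linarith
    exact this.ne'
  -- Truncated subtraction keeps `bfCoeff D n A` from vanishing automatically when `2A > n`; `c` is
  -- the coefficient extended by zero.
  set c : ℕ → ℝ := fun A => if 2 * A ≤ n then bfCoeff D n A else 0 with hc
  have e1 : N * s * (∑ A ∈ Finset.range (n / 2 + 1), bfCoeff D n A * (r * z) ^ A *
        s ^ (n - 2 * A)) -
        r * ∑ A ∈ Finset.range (n / 2 + 1), bfCoeff D n A *
          (A * (r * z) ^ (A - 1) * (2 * s * z) * s ^ (n - 2 * A) +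
            (r * z) ^ A * ((n - 2 * A : ℕ) * s ^ (n - 2 * A - 1) * z)) =
      ∑ A ∈ Finset.range (n / 2 + 1), c A * (N - 2 * A) * (r * z) ^ A * s ^ (n + 1 - 2 * A) -
        ∑ A ∈ Finset.range (n / 2 + 1), bfCoeff D n A * ((n : ℝ) - 2 * A) * (r * z) ^ (A + 1) *
          s ^ (n - 2 * A - 1) := by
    rw [Finset.mul_sum, Finset.mul_sum, ← Finset.sum_sub_distrib, ← Finset.sum_sub_distrib]
    refine Finset.sum_congr rfl fun A hA => ?_
    have hA' : 2 * A ≤ n := by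
      have := Finset.mem_range.1 hA
      omega
    have h1 : s ^ (n + 1 - 2 * A) = s * s ^ (n - 2 * A) := by
      rw [← pow_succ', Nat.sub_add_comm hA']
    have h2 : (A : ℝ) * (r * z) ^ A = A * (r * z) ^ (A - 1) * (r * z) := by
      rcases A with _ | A
      · simp
      · rw [Nat.add_sub_cancel, pow_succ]
        ring
    simp only [hc, if_pos hA', h1, pow_succ]
    rw [Nat.cast_sub hA']
    push_cast
    linear_combination (2 * bfCoeff D n A * s * s ^ (n - 2 * A)) * h2
  -- The ranges are aligned with that of rank `n + 1`. For odd `n` the first sum gains a term with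
  -- `c = 0`; for even `n` the second loses a term with `n - 2A = 0`.
  have e2 : ∑ A ∈ Finset.range (n / 2 + 1), c A * (N - 2 * A) * (r * z) ^ A *
        s ^ (n + 1 - 2 * A) =
      ∑ A ∈ Finset.range ((n + 1) / 2 + 1), c A * (N - 2 * A) * (r * z) ^ A *
        s ^ (n + 1 - 2 * A) := by
    refine Finset.sum_subset (Finset.range_subset_range.2 (by omega)) fun A _ hA => ?_
    have : ¬ 2 * A ≤ n := by
      rw [Finset.mem_range] at hA
      omega
    simp [hc, this]
  have e3 : ∑ A ∈ Finset.range (n / 2 + 1), bfCoeff D n A * ((n : ℝ) - 2 * A) *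
        (r * z) ^ (A + 1) * s ^ (n - 2 * A - 1) =
      ∑ A ∈ Finset.range ((n + 1) / 2), bfCoeff D n A * ((n : ℝ) - 2 * A) *
        (r * z) ^ (A + 1) * s ^ (n - 2 * A - 1) := by
    symm
    refine Finset.sum_subset (Finset.range_subset_range.2 (by omega)) fun A hA hA' => ?_
    have h : n = 2 * A := by
      rw [Finset.mem_range] at hA hA'
      omega
    have h' : (n : ℝ) - 2 * A = 0 := by
      rw [sub_eq_zero]
      exact_mod_cast h
    rw [h']
    ring
  rw [e1, e2, e3, Finset.mul_sum, Finset.sum_range_succ', Finset.sum_range_succ' _ ((n + 1) / 2),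
    add_sub_right_comm, ← Finset.sum_sub_distrib]
  congr 1
  · refine Finset.sum_congr rfl fun A hA => ?_
    have hA' : 2 * A + 1 ≤ n := by
      rw [Finset.mem_range] at hA
      omega
    have h1 := mul_bfCoeff_succ_succ (D := D) hA' hN0
    have h2 : (N - 2 * (A + 1 : ℕ)) * c (A + 1) =
        -(bfCoeff D n A * ((n : ℝ) - 2 * A) * (n - 2 * A - 1) / (2 * (A + 1))) := by
      by_cases h : 2 * (A + 1) ≤ n
      · have hA2 : (2 : ℝ) * (A + 1) ≤ n := by exact_mod_cast h
        have h0 : (D : ℝ) + 2 * n - 2 * A - 5 ≠ 0 := by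
          have hA0 : (0 : ℝ) ≤ A := Nat.cast_nonneg A
          have : 0 < (D : ℝ) + 2 * n - 2 * A - 5 := by linarith
          exact this.ne'
        simp only [hc, if_pos h]
        rw [← mul_bfCoeff_succ h h0, hN]
        push_cast
        ring
      · have hA2 : (n : ℝ) = 2 * A + 1 := by
          have : n = 2 * A + 1 := by omega
          exact_mod_cast this
        simp only [hc, if_neg h, hA2]
        ring
    rw [show n + 1 - 2 * (A + 1) = n - 2 * A - 1 by omega]
    have hA1 : (A : ℝ) + 1 ≠ 0 := by positivity
    -- After both ratio formulas this reduces to `(n + 1) - (n - 2A - 1) = 2(A + 1)`.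
    have h3 : N * bfCoeff D (n + 1) (A + 1) = c (A + 1) * (N - 2 * (A + 1 : ℕ)) -
        bfCoeff D n A * ((n : ℝ) - 2 * A) := by
      rw [h1, mul_comm (c _), h2]
      field_simp
      ring
    linear_combination ((r * z) ^ (A + 1) * s ^ (n - 2 * A - 1)) * h3
  · simp [hc, bfCoeff_zero]

end Coefficients

/-! ### Contraction of a tensor with powers of one covector. -/

section PolyForm

variable {ι : Type} [Fintype ι] {n : ℕ}

/-- The contraction of the tensor `x` with `n` copies of the covector `v`. -/
def polyForm (v : ι → ℝ) (x : (Fin n → ι) → ℝ) : ℝ := ∑ i, (∏ m, v (i m)) * x i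

theorem polyForm_add (v : ι → ℝ) (x y : (Fin n → ι) → ℝ) :
    polyForm v (x + y) = polyForm v x + polyForm v y := by
  simp only [polyForm, Pi.add_apply, mul_add, Finset.sum_add_distrib]

theorem polyForm_sub (v : ι → ℝ) (x y : (Fin n → ι) → ℝ) :
    polyForm v (x - y) = polyForm v x - polyForm v y := by
  simp only [polyForm, Pi.sub_apply, mul_sub, Finset.sum_sub_distrib]

theorem polyForm_smul (v : ι → ℝ) (c : ℝ) (x : (Fin n → ι) → ℝ) :
    polyForm v (c • x) = c * polyForm v x := by
  simp only [polyForm, Pi.smul_apply, smul_eq_mul, Finset.mul_sum]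
  exact Finset.sum_congr rfl fun i _ => by ring

theorem polyForm_sum {α : Type} (v : ι → ℝ) (s : Finset α) (x : α → (Fin n → ι) → ℝ) :
    polyForm v (∑ a ∈ s, x a) = ∑ a ∈ s, polyForm v (x a) := by
  simp only [polyForm, Finset.sum_apply, Finset.mul_sum]
  exact Finset.sum_comm

theorem polyForm_comp (v : ι → ℝ) (π : Equiv.Perm (Fin n)) (x : (Fin n → ι) → ℝ) :
    polyForm v (fun i => x (i ∘ π)) = polyForm v x := by
  refine Fintype.sum_equiv (slotEquiv π) _ _ fun i => ?_
  rw [← Equiv.prod_comp π fun m => v (i m)]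
  rfl

theorem sum_fin_succ {M : Type} [AddCommMonoid M] (f : (Fin (n + 1) → ι) → M) :
    ∑ i, f i = ∑ t, ∑ i : Fin n → ι, f (Fin.cons t i) := by
  rw [← Fintype.sum_prod_type']
  exact (Fintype.sum_equiv (Fin.consEquiv fun _ => ι) _ _ fun _ => rfl).symm

/-- Exchanging `t` with the entry `i l` is an involution of the summation range that decouples the
two sums. -/
theorem sum_mul_sum_update [DecidableEq ι] (l : Fin n) (g : ι → ℝ) (f : (Fin n → ι) → ℝ) :
    ∑ i, g (i l) * ∑ t, f (Function.update i l t) = (∑ t, g t) * ∑ i, f i := by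
  simp only [Finset.mul_sum, Finset.sum_mul]
  rw [Finset.sum_comm (s := Finset.univ (α := Fin n → ι)) (t := Finset.univ (α := ι)),
    ← Fintype.sum_prod_type', Finset.sum_comm, ← Fintype.sum_prod_type']
  have hinv : Function.Involutive
      (fun z : ι × (Fin n → ι) => (z.2 l, Function.update z.2 l z.1)) := fun z => by
    simp
  exact Fintype.sum_equiv hinv.toPerm _ _ fun z => rfl

/-- The product rule in each slot. The sum so obtained is what the caps produce below, which allows
it to be read as a derivative of the lower generating function. -/
theorem hasDerivAt_polyForm (v w : ι → ℝ) (x : (Fin n → ι) → ℝ) :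
    HasDerivAt (fun t : ℝ => polyForm (v + t • w) x)
      (∑ l, ∑ i, (∏ m ∈ Finset.univ.erase l, v (i m)) * w (i l) * x i) 0 := by
  rw [Finset.sum_comm]
  refine HasDerivAt.fun_sum fun i _ => ?_
  rw [← Finset.sum_mul]
  refine HasDerivAt.mul_const ?_ _
  have h := HasDerivAt.fun_finsetProd (u := Finset.univ) (f := fun (m : Fin n) (t : ℝ) =>
    (v + t • w) (i m)) (f' := fun m => w (i m)) (x := 0) fun m _ => by
      have := ((hasDerivAt_id (0 : ℝ)).mul_const (w (i m))).const_add (v (i m))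
      simpa using this
  simpa using h

end PolyForm

/-! ### Reduction of the rank `n + 1` projector to rank `n`. -/

section GenFun

variable {p q n : ℕ} {k : Idx p q → ℝ}

/-- The tensor power of the vector `x`. -/
def tensorPow (n : ℕ) (x : Idx p q → ℝ) (r : Fin n → Idx p q) : ℝ := ∏ m, x (r m)

theorem genFun_eq_polyForm (T : Matrix (Fin n → Idx p q) (Fin n → Idx p q) ℝ)
    (x u : Idx p q → ℝ) : genFun T x u = polyForm (lower u) (T *ᵥ tensorPow n x) := by
  simp only [genFun, polyForm, Matrix.mulVec, dotProduct, Finset.mul_sum, tensorPow, mul_assoc]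

/-- The product of the vector `y` in the first slot and the tensor `x` in the remaining ones. -/
def consTensor (y : Idx p q → ℝ) (x : (Fin n → Idx p q) → ℝ) (i : Fin (n + 1) → Idx p q) : ℝ :=
  y (i 0) * x (Fin.tail i)

theorem sum_lower_mul_Theta_mulVec (hk : sq k ≠ 0) (x : Idx p q → ℝ) :
    ∑ t, lower k t * (Theta k *ᵥ x) t = 0 := by
  have h : Theta k *ᵥ (Theta k *ᵥ x) = Theta k *ᵥ x := by
    rw [Matrix.mulVec_mulVec, Theta_idem hk]
  obtain ⟨c, hc⟩ : ∃ c, k c ≠ 0 := by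
    by_contra! h
    exact hk (by simp [sq, h])
  have h1 : ∑ t, Theta k c t * (Theta k *ᵥ x) t = (Theta k *ᵥ x) c := congrFun h c
  rw [sum_Theta_mul] at h1
  have h2 : k c / sq k * ∑ t, lower k t * (Theta k *ᵥ x) t = 0 := by linarith
  exact (mul_eq_zero.1 h2).resolve_left (div_ne_zero hc hk)

/-- This supplies the input for one harmonic step in which slot `0` is the one to be adjoined. -/
theorem isSymmetricTTOn_consTensor {y : Idx p q → ℝ} (hy : ∑ t, lower k t * y t = 0)
    {x : (Fin n → Idx p q) → ℝ} (hx : IsSymmetricTT k x) :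
    IsSymmetricTTOn k (Finset.univ.erase 0) (consTensor y x) := by
  have hS : ∀ a ∈ Finset.univ.erase (0 : Fin (n + 1)), ∃ b : Fin n, a = b.succ := fun a ha =>
    (Fin.exists_succ_eq.2 (Finset.ne_of_mem_erase ha)).imp fun _ h => h.symm
  have h0 : ∀ (i : Fin (n + 1) → Idx p q) (b : Fin n) t, Function.update i b.succ t 0 = i 0 :=
    fun i b t => Function.update_of_ne (Fin.succ_ne_zero b).symm _ _
  refine ⟨fun a ha b hb i => ?_, fun a i => ?_, fun a ha b hb hab i => ?_⟩
  · obtain ⟨a, rfl⟩ := hS a ha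
    obtain ⟨b, rfl⟩ := hS b hb
    have h1 : Fin.tail (i ∘ Equiv.swap a.succ b.succ) = Fin.tail i ∘ Equiv.swap a b := by
      funext m
      simp only [Fin.tail, Function.comp_apply]
      congr 1
      exact (Fin.succ_injective n).swap_apply a b m
    have h2 : (i ∘ Equiv.swap a.succ b.succ) 0 = i 0 := by
      rw [Function.comp_apply, Equiv.swap_apply_of_ne_of_ne (Fin.succ_ne_zero a).symm
        (Fin.succ_ne_zero b).symm]
    rw [consTensor, h1, h2, hx.symm, consTensor]
  · rcases Fin.eq_zero_or_eq_succ a with rfl | ⟨a, rfl⟩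
    · simp only [consTensor, Function.update_self, Fin.tail_update_zero, ← mul_assoc]
      rw [← Finset.sum_mul, hy, zero_mul]
    · simp only [consTensor, h0, Fin.tail_update_succ, mul_left_comm _ (y (i 0))]
      rw [← Finset.mul_sum, hx.transverse, mul_zero]
  · obtain ⟨a, rfl⟩ := hS a ha
    obtain ⟨b, rfl⟩ := hS b hb
    simp only [consTensor, h0, Fin.tail_update_succ, mul_left_comm _ (y (i 0))]
    rw [← Finset.mul_sum, hx.traceless a b (fun h => hab (congrArg _ h)), mul_zero]

theorem matrix_eq_of_mulVec_eq {α : Type} [Fintype α] [DecidableEq α] {A B : Matrix α α ℝ}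
    (h : ∀ x, A *ᵥ x = B *ᵥ x) : A = B :=
  Matrix.mulVec_injective (funext h)

/-- The spin projector absorbs the spin projector of lower rank. -/
theorem spinProjector_mulVec_consTensor (hD : 2 ≤ p + q) (hn : 1 ≤ n) (hk : sq k ≠ 0)
    (x : Idx p q → ℝ) :
    spinProjector (n + 1) k *ᵥ
        consTensor (Theta k *ᵥ x) (spinProjector n k *ᵥ tensorPow n x) =
      spinProjector (n + 1) k *ᵥ tensorPow (n + 1) x := by
  -- `M` is `Θ ⊗ Π_n`; it sends `x^{⊗(n+1)}` to the tensor on the left-hand side.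
  set M : Matrix (Fin (n + 1) → Idx p q) (Fin (n + 1) → Idx p q) ℝ :=
    Matrix.of fun i r => Theta k (i 0) (r 0) * spinProjector n k (Fin.tail i) (Fin.tail r) with hM
  have hMx : ∀ z i, (M *ᵥ z) i = ∑ t, Theta k (i 0) t *
      (spinProjector n k *ᵥ fun r => z (Fin.cons t r)) (Fin.tail i) := fun z i => by
    refine (sum_fin_succ _).trans (Finset.sum_congr rfl fun t _ => ?_)
    simp only [hM, Matrix.of_apply, Fin.cons_zero, Fin.tail_cons, mul_assoc, ← Finset.mul_sum]
    rfl
  have h1 : consTensor (Theta k *ᵥ x) (spinProjector n k *ᵥ tensorPow n x) =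
      M *ᵥ tensorPow (n + 1) x := by
    funext i
    rw [hMx, consTensor]
    have : ∀ t, (fun r : Fin n → Idx p q => tensorPow (n + 1) x (Fin.cons t r)) =
        x t • tensorPow n x := fun t => by
      funext r
      rw [tensorPow, Fin.prod_univ_succ]
      rfl
    simp only [this, Matrix.mulVec_smul, Pi.smul_apply, smul_eq_mul, ← mul_assoc]
    rw [← Finset.sum_mul]
    rfl
  have hMsa : IsSelfAdjointFor (eta p q) M := by
    refine isSelfAdjointFor_iff.2 fun l i => ?_
    have h := isSelfAdjointFor_iff.1 (spinProjector_hermitian (j := n) hk) (Fin.tail l)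
      (Fin.tail i)
    rw [Fin.prod_univ_succ, Fin.prod_univ_succ]
    simp only [hM, Matrix.of_apply]
    have e : ∀ i : Fin (n + 1) → Idx p q, ∏ m : Fin n, eta p q (i m.succ) =
      ∏ m : Fin n, eta p q (Fin.tail i m) := fun i => rfl
    rw [e, e]
    linear_combination (eta p q (l 0) * Theta k (l 0) (i 0)) * h +
      ((∏ m : Fin n, eta p q (Fin.tail i m)) * spinProjector n k (Fin.tail i) (Fin.tail l)) *
        eta_mul_Theta k (l 0) (i 0)
  -- Fixing the first index of a symmetric, transverse, traceless tensor leaves one of rank `n`,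
  -- which `Π_n` fixes, and transversality in slot `0` takes care of `Θ`. The adjoint relation is
  -- the one needed.
  have h2 : M * spinProjector (n + 1) k = (1 : ℝ) • spinProjector (n + 1) k := by
    rw [one_smul]
    refine matrix_eq_of_mulVec_eq fun z => ?_
    rw [← Matrix.mulVec_mulVec]
    have hz := isSymmetricTT_spinProjector_mulVec hD (Nat.le_add_left 1 n) hk z
    generalize spinProjector (n + 1) k *ᵥ z = w at hz
    have hw : ∀ t, IsSymmetricTT k fun r => w (Fin.cons t r) := fun t => by
      refine ⟨fun a b r => ?_, fun a r => ?_, fun a b hab r => ?_⟩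
      · rw [← hz.symm a.succ b.succ]
        congr 1
        funext m
        rcases Fin.eq_zero_or_eq_succ m with rfl | ⟨m, rfl⟩
        · rw [Function.comp_apply, Equiv.swap_apply_of_ne_of_ne (Fin.succ_ne_zero a).symm
            (Fin.succ_ne_zero b).symm, Fin.cons_zero, Fin.cons_zero]
        · rw [Function.comp_apply, (Fin.succ_injective n).swap_apply, Fin.cons_succ,
            Fin.cons_succ, Function.comp_apply, Equiv.swap_apply_self]
      · simpa only [Fin.cons_update] using hz.transverse a.succ (Fin.cons t r)
      · simpa only [Fin.cons_update] using hz.traceless a.succ b.succ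
          (fun h => hab (Fin.succ_injective n h)) (Fin.cons t r)
    funext i
    rw [hMx]
    simp only [spinProjector_mulVec hD hn hk (hw _)]
    rw [sum_Theta_mul, Fin.cons_self_tail]
    have h3 := hz.transverse 0 i
    have h4 : ∀ t, (Fin.cons t (Fin.tail i) : Fin (n + 1) → Idx p q) =
        Function.update i 0 t := fun t => by
      rw [← Fin.cons_self_tail i, Fin.update_cons_zero, Fin.tail_cons]
    simp only [h4]
    rw [h3, mul_zero, sub_zero]
  have h3 := (spinProjector_hermitian hk).mul_eq_smul hMsa h2
  rw [h1, Matrix.mulVec_mulVec, h3, one_smul]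

end GenFun

/-! ### The recursion for generating functions and its solution. -/

section Recursion

variable {p q n : ℕ} {k : Idx p q → ℝ}

theorem sum_lower_mul_Theta_mulVec_eq_thetaForm (k x u : Idx p q → ℝ) :
    ∑ t, lower u t * (Theta k *ᵥ x) t = thetaForm k x u := by
  rw [thetaForm, Finset.sum_comm]
  refine Finset.sum_congr rfl fun t _ => ?_
  rw [Matrix.mulVec, dotProduct, Finset.mul_sum]
  exact Finset.sum_congr rfl fun r _ => by ring

theorem thetaForm_comm (k x u : Idx p q → ℝ) : thetaForm k x u = thetaForm k u x := by
  rw [thetaForm, thetaForm, Finset.sum_comm]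
  refine Finset.sum_congr rfl fun t _ => Finset.sum_congr rfl fun r _ => ?_
  rw [lower, lower]
  linear_combination (x r * u t) * eta_mul_Theta k t r

theorem thetaForm_add_smul_right (k x u y : Idx p q → ℝ) (t : ℝ) :
    thetaForm k x (u + t • y) = thetaForm k x u + t * thetaForm k x y := by
  simp only [← sum_lower_mul_Theta_mulVec_eq_thetaForm, Finset.mul_sum, ← Finset.sum_add_distrib]
  refine Finset.sum_congr rfl fun r _ => ?_
  simp only [lower, Pi.add_apply, Pi.smul_apply, smul_eq_mul]
  ring

theorem thetaForm_add_smul_left (k x u y : Idx p q → ℝ) (t : ℝ) :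
    thetaForm k (u + t • y) x = thetaForm k u x + t * thetaForm k y x := by
  rw [thetaForm_comm, thetaForm_add_smul_right, thetaForm_comm k x u, thetaForm_comm k x y]

theorem thetaForm_Theta_mulVec_left (hk : sq k ≠ 0) (x u : Idx p q → ℝ) :
    thetaForm k (Theta k *ᵥ x) u = thetaForm k x u := by
  rw [← sum_lower_mul_Theta_mulVec_eq_thetaForm, ← sum_lower_mul_Theta_mulVec_eq_thetaForm,
    Matrix.mulVec_mulVec, Theta_idem hk]

theorem thetaForm_Theta_mulVec_right (hk : sq k ≠ 0) (x u : Idx p q → ℝ) :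
    thetaForm k u (Theta k *ᵥ x) = thetaForm k u x := by
  rw [thetaForm_comm, thetaForm_Theta_mulVec_left hk, thetaForm_comm]

theorem lower_add_smul (u y : Idx p q → ℝ) (t : ℝ) :
    lower (u + t • y) = lower u + t • lower y := by
  funext r
  simp only [lower, Pi.add_apply, Pi.smul_apply, smul_eq_mul]
  ring

theorem polyForm_consTensor (v y : Idx p q → ℝ) (x : (Fin n → Idx p q) → ℝ) :
    polyForm v (consTensor y x) = (∑ t, v t * y t) * polyForm v x := by
  rw [polyForm, sum_fin_succ, Finset.sum_mul]
  refine Finset.sum_congr rfl fun t _ => ?_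
  rw [polyForm, Finset.mul_sum]
  refine Finset.sum_congr rfl fun i _ => ?_
  simp only [Fin.prod_univ_succ, Fin.cons_zero, Fin.cons_succ, consTensor, Fin.tail_cons]
  ring

/-- `Θcheck` contracted with two copies of `u` splits off as `Θ^{(u)}_{(u)}`, while the trace
inserts `y` into slot `l` of `x`. -/
theorem polyForm_capOp_mulVec_consTensor (hk : sq k ≠ 0) (u : Idx p q → ℝ) {y : Idx p q → ℝ}
    (hy : ∑ t, lower k t * y t = 0) {x : (Fin n → Idx p q) → ℝ} (hx : IsSymmetricTT k x)
    (l : Fin n) :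
    polyForm (lower u) (capOp (Theta k) (ThetaHat k) (ThetaCheck k) l.succ 0 *ᵥ
        consTensor y x) =
      thetaForm k u u *
        ∑ i, (∏ m ∈ Finset.univ.erase l, lower u (i m)) * lower y (i l) * x i := by
  have hψ := isSymmetricTTOn_consTensor hy hx
  have h1 : ∑ s, lower u s * ∑ t, lower u t * ThetaCheck k s t = thetaForm k u u := by
    rw [← sum_lower_mul_Theta_mulVec_eq_thetaForm]
    refine Finset.sum_congr rfl fun s _ => ?_
    rw [Matrix.mulVec, dotProduct]
    congr 1
    refine Finset.sum_congr rfl fun t _ => ?_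
    rw [ThetaCheck_apply, lower]
    linear_combination (u t * Theta k s t) * eta_mul_eta t
  rw [← h1, ← sum_mul_sum_update l, polyForm, sum_fin_succ, Finset.sum_comm]
  refine Finset.sum_congr rfl fun i _ => ?_
  have h2 : ∀ t, (∏ m ∈ Finset.univ.erase l, lower u (Function.update i l t m)) =
      ∏ m ∈ Finset.univ.erase l, lower u (i m) := fun t =>
    Finset.prod_congr rfl fun m hm => by rw [Function.update_of_ne (Finset.ne_of_mem_erase hm)]
  have h3 : ∀ s, (capOp (Theta k) (ThetaHat k) (ThetaCheck k) l.succ 0 *ᵥ consTensor y x)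
      (Fin.cons s i) = ThetaCheck k (i l) s * ∑ t, lower y t * x (Function.update i l t) :=
    fun s => by
      rw [capOp_Theta_mulVec_apply hk hψ.transverse (Fin.succ_ne_zero l), Fin.cons_zero,
        Fin.cons_succ]
      congr 1
      refine Finset.sum_congr rfl fun t _ => ?_
      rw [← Fin.cons_update, Fin.update_cons_zero, consTensor, Fin.cons_zero, Fin.tail_cons,
        lower, mul_assoc]
  simp only [h2, h3, Function.update_self]
  simp only [mul_assoc, ← Finset.mul_sum]
  rw [Finset.sum_mul, Finset.mul_sum]
  refine Finset.sum_congr rfl fun s _ => ?_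
  rw [Fin.prod_univ_succ, ← Finset.mul_prod_erase _ _ (Finset.mem_univ l)]
  simp only [Fin.cons_zero, Fin.cons_succ]
  ring

theorem isSelfAdjointFor_jmOp (S : Finset (Fin n)) {m : Fin n} (hm : m ∉ S) :
    IsSelfAdjointFor (eta p q) (jmOp (Theta k) (ThetaHat k) (ThetaCheck k) S m) := by
  refine Finset.sum_induction _ (IsSelfAdjointFor (eta p q)) (fun _ _ => IsSelfAdjointFor.add)
    IsSelfAdjointFor.zero fun l hl => ?_
  exact (isSelfAdjointFor_permOp (eta_mul_Theta k) (Equiv.swap_mul_self _ _)).sub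
    (isSelfAdjointFor_capOp (eta_mul_Theta k) (eta_mul_eta_mul_ThetaCheck k)
      (ne_of_mem_of_not_mem hl hm))

/-- The adjoint of the eigenvalue equation on the image of the projector. -/
theorem spinProjector_mul_jmOp (hD : 2 ≤ p + q) (hn : 1 ≤ n) (hk : sq k ≠ 0)
    (S : Finset (Fin n)) {m : Fin n} (hm : m ∉ S) :
    spinProjector n k * jmOp (Theta k) (ThetaHat k) (ThetaCheck k) S m =
      (S.card : ℝ) • spinProjector n k := by
  refine (spinProjector_hermitian hk).mul_eq_smul (isSelfAdjointFor_jmOp S hm)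
    (matrix_eq_of_mulVec_eq fun x => ?_)
  rw [← Matrix.mulVec_mulVec, Matrix.smul_mulVec]
  exact ((isHarmonicOn_iff hD hk).2 (isSymmetricTTOn_univ.2
    (isSymmetricTT_spinProjector_mulVec hD hn hk x))).jmOp_mulVec (Finset.mem_univ m) hm
      (Finset.subset_univ S)

theorem IsHarmonicOn.polyForm_swap_mulVec {S : Finset (Fin n)} {x : (Fin n → Idx p q) → ℝ}
    (hx : IsHarmonicOn (Theta k) (ThetaHat k) (ThetaCheck k) S x) (v : Idx p q → ℝ) (a b : Fin n) :
    polyForm v (permOp (Theta k) (Equiv.swap a b) *ᵥ x) = polyForm v x := by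
  rw [← polyForm_comp v (Equiv.swap a b) x]
  congr 1
  funext i
  rw [permOp_mulVec_apply, hx.proj, Equiv.symm_swap]

/-- The generating functions for the ranks `n` and `n + 1`. -/
theorem genFun_spinProjector_succ (hD : 2 ≤ p + q) (hn : 1 ≤ n) (hk : sq k ≠ 0)
    (x u : Idx p q → ℝ) {d : ℝ}
    (hd : HasDerivAt (fun t : ℝ => genFun (spinProjector n k) x (u + t • (Theta k *ᵥ x))) d 0) :
    (((p + q : ℕ) : ℝ) + 2 * n - 3) * genFun (spinProjector (n + 1) k) x u =
      (((p + q : ℕ) : ℝ) + 2 * n - 3) * thetaForm k x u * genFun (spinProjector n k) x u -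
        thetaForm k u u * d := by
  set y := Theta k *ᵥ x with hy
  have hky : ∑ t, lower k t * y t = 0 := sum_lower_mul_Theta_mulVec hk x
  set φ := spinProjector n k *ᵥ tensorPow n x with hφ
  have hφTT : IsSymmetricTT k φ := isSymmetricTT_spinProjector_mulVec hD hn hk _
  have hd' : d = ∑ l, ∑ i, (∏ m ∈ Finset.univ.erase l, lower u (i m)) * lower y (i l) * φ i := by
    refine hd.unique ?_
    have h := hasDerivAt_polyForm (lower u) (lower y) φ
    simpa only [genFun_eq_polyForm, lower_add_smul] using h
  set S : Finset (Fin (n + 1)) := Finset.univ.erase 0 with hS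
  have h0S : (0 : Fin (n + 1)) ∉ S := Finset.notMem_erase _ _
  have hcard : (S.card : ℝ) = n := by simp [hS]
  have H := Theta_isTriple_real (p := p) (q := q) hk
  have hψ := (isHarmonicOn_iff hD hk).2 (isSymmetricTTOn_consTensor hky hφTT)
  rw [← hS] at hψ
  set ψ := consTensor y φ with hψdef
  set Y := jmOp (Theta k) (ThetaHat k) (ThetaCheck k) S 0 with hY
  have hχ := hψ.jmOp_add_smul_mulVec H h0S ((p : ℝ) + q - 1 + (S.card : ℝ) - 2)
  have hcap := fun l (hl : l ∈ S) => hψ.cap_mul_jmOp_add_smul_mulVec H h0S hl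
  have hΦ := hψ.step H h0S
  rw [← hY] at hχ hcap hΦ
  set χ := (Y + ((p : ℝ) + q - 1 + (S.card : ℝ) - 2) • 1) *ᵥ ψ with hχdef
  have hinsert : insert 0 S = Finset.univ := Finset.insert_erase (Finset.mem_univ _)
  rw [hinsert] at hΦ
  have hΦTT := isSymmetricTTOn_univ.1 ((isHarmonicOn_iff hD hk).1 hΦ)
  have hn1 : (n : ℝ) + 1 ≠ 0 := by positivity
  have hsum : ∀ f : Fin (n + 1) → ℝ, ∑ l ∈ S, f l = ∑ l : Fin n, f l.succ := fun f => by
    have := Finset.add_sum_erase Finset.univ f (Finset.mem_univ 0)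
    rw [Fin.sum_univ_succ] at this
    exact add_left_cancel this
  -- The result of the step is fixed by `Π_{n+1}`. Moved to the right of `Π_{n+1}`, `Y` becomes `n`,
  -- so the two factors give `(n + 1)(D + 2n - 3)`.
  have e1 : (Y + (1 : ℝ) • 1) *ᵥ χ = (((n : ℝ) + 1) * ((p : ℝ) + q + 2 * n - 3)) •
      (spinProjector (n + 1) k *ᵥ tensorPow (n + 1) x) := by
    rw [← spinProjector_mulVec hD (Nat.le_add_left 1 n) hk hΦTT,
      ← spinProjector_mulVec_consTensor hD hn hk, ← hψdef, hχdef, Matrix.mulVec_mulVec,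
      Matrix.mulVec_mulVec, ← Matrix.smul_mulVec]
    congr 1
    have hT := spinProjector_mul_jmOp hD (Nat.le_add_left 1 n) hk S h0S
    rw [← hY, hcard] at hT
    rw [mul_add, mul_add, mul_smul_comm, mul_smul_comm, mul_one, mul_one, add_mul]
    simp only [smul_mul_assoc, one_mul, hT, hcard, smul_add, smul_smul, mul_one]
    module
  -- A contraction with equal covectors does not see flips, and the caps vanish on `χ`: each of the
  -- `n` summands contributes one copy.
  have e2 : polyForm (lower u) ((Y + (1 : ℝ) • 1) *ᵥ χ) =
      ((n : ℝ) + 1) * polyForm (lower u) χ := by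
    rw [one_smul, Matrix.add_mulVec, Matrix.one_mulVec, polyForm_add, hY, jmOp, Matrix.sum_mulVec,
      polyForm_sum, Finset.sum_congr rfl (g := fun _ => polyForm (lower u) χ), Finset.sum_const,
      nsmul_eq_mul, hcard]
    · ring
    · intro l hl
      rw [flipSubCap, Matrix.sub_mulVec, hcap l hl, sub_zero, hχ.polyForm_swap_mulVec]
  -- On `ψ` the caps survive: the `n` flips raise the shift `D + n - 3` to `D + 2n - 3`, and the
  -- caps add up to the derivative `d`.
  have e3 : polyForm (lower u) χ = ((p : ℝ) + q + 2 * n - 3) * polyForm (lower u) ψ -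
      thetaForm k u u * d := by
    rw [hχdef, Matrix.add_mulVec, Matrix.smul_mulVec, Matrix.one_mulVec, polyForm_add,
      polyForm_smul, hY, jmOp, Matrix.sum_mulVec, polyForm_sum,
      Finset.sum_congr rfl (g := fun l => polyForm (lower u) ψ -
        polyForm (lower u) (capOp (Theta k) (ThetaHat k) (ThetaCheck k) l 0 *ᵥ ψ)),
      Finset.sum_sub_distrib, Finset.sum_const, nsmul_eq_mul, hsum, hcard]
    · simp only [hψdef, polyForm_capOp_mulVec_consTensor hk u hky hφTT]
      rw [← Finset.mul_sum, ← hd']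
      ring
    · intro l hl
      rw [flipSubCap, Matrix.sub_mulVec, polyForm_sub, hψ.polyForm_swap_mulVec]
  have e4 : polyForm (lower u) ψ = thetaForm k x u * polyForm (lower u) φ := by
    rw [hψdef, polyForm_consTensor, hy, sum_lower_mul_Theta_mulVec_eq_thetaForm]
  have e5 : polyForm (lower u) ((Y + (1 : ℝ) • 1) *ᵥ χ) =
      (((n : ℝ) + 1) * ((p : ℝ) + q + 2 * n - 3)) *
        polyForm (lower u) (spinProjector (n + 1) k *ᵥ tensorPow (n + 1) x) := by
    rw [e1, polyForm_smul]
  rw [e2, e3, e4] at e5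
  rw [genFun_eq_polyForm, genFun_eq_polyForm, Nat.cast_add]
  apply mul_left_cancel₀ hn1
  linear_combination -e5

/-- Let `s`, `r`, `z` be the values of `Θ` on `(x,u)`, `(u,u)`, `(x,x)`. Along `u + tΘx`,
idempotence of `Θ` gives `s + tz` and `r + 2ts + t²z`, with `z` constant. -/
theorem hasDerivAt_bfGenFun (hk : sq k ≠ 0) (x u : Idx p q → ℝ) :
    HasDerivAt (fun t : ℝ => bfGenFun n k x (u + t • (Theta k *ᵥ x)))
      (∑ A ∈ Finset.range (n / 2 + 1), bfCoeff (p + q) n A *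
        (A * (thetaForm k u u * thetaForm k x x) ^ (A - 1) *
            (2 * thetaForm k x u * thetaForm k x x) * thetaForm k x u ^ (n - 2 * A) +
          (thetaForm k u u * thetaForm k x x) ^ A *
            ((n - 2 * A : ℕ) * thetaForm k x u ^ (n - 2 * A - 1) * thetaForm k x x))) 0 := by
  set s := thetaForm k x u with hs
  set z := thetaForm k x x with hz
  set r := thetaForm k u u with hr
  have h1 : ∀ t : ℝ, thetaForm k x (u + t • (Theta k *ᵥ x)) = s + t * z := fun t => by
    rw [thetaForm_add_smul_right, thetaForm_Theta_mulVec_right hk]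
  have h2 : ∀ t : ℝ, thetaForm k (u + t • (Theta k *ᵥ x)) (u + t • (Theta k *ᵥ x)) =
      r + t * (2 * s) + t * t * z := fun t => by
    rw [thetaForm_add_smul_left, thetaForm_add_smul_right, thetaForm_add_smul_right,
      thetaForm_Theta_mulVec_right hk, thetaForm_Theta_mulVec_left hk,
      thetaForm_Theta_mulVec_left hk, thetaForm_Theta_mulVec_right hk, thetaForm_comm k u x]
    ring
  have d1 : HasDerivAt (fun t : ℝ => s + t * z) z 0 := by
    simpa using ((hasDerivAt_id (0 : ℝ)).mul_const z).const_add s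
  have d2 : HasDerivAt (fun t : ℝ => (r + t * (2 * s) + t * t * z) * z) (2 * s * z) 0 := by
    have := ((((hasDerivAt_id (0 : ℝ)).mul_const (2 * s)).const_add r).add
      (((hasDerivAt_id (0 : ℝ)).mul (hasDerivAt_id (0 : ℝ))).mul_const z)).mul_const z
    simpa using this
  simp only [bfGenFun, h1, h2]
  refine HasDerivAt.fun_sum fun A _ => ?_
  have h := ((d2.fun_pow A).mul (d1.fun_pow (n - 2 * A))).const_mul (bfCoeff (p + q) n A)
  simpa [mul_assoc] using h

theorem genFun_spinProjector_one (x u : Idx p q → ℝ) :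
    genFun (spinProjector 1 k) x u = thetaForm k x u := by
  have h : spinProjector 1 k = permOp (Theta k) 1 := by
    simp [spinProjector, harmonicOp]
  rw [h, genFun, thetaForm, Finset.sum_comm]
  refine Fintype.sum_equiv (Equiv.funUnique (Fin 1) _) _ _ fun r =>
    Fintype.sum_equiv (Equiv.funUnique (Fin 1) _) _ _ fun i => ?_
  simp [permOp]
  ring

theorem genFun_spinProjector (hD : 2 ≤ p + q) (hn : 1 ≤ n) (hk : sq k ≠ 0)
    (x u : Idx p q → ℝ) : genFun (spinProjector n k) x u = bfGenFun n k x u := by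
  -- The point `u` must vary, since the derivative in the recursion uses the rank `n` formula along
  -- a whole line.
  induction n, hn using Nat.le_induction generalizing u with
  | base => simp [genFun_spinProjector_one, bfGenFun, bfCoeff_zero]
  | succ n hn ih =>
    have hd := hasDerivAt_bfGenFun (n := n) hk x u
    simp only [← ih] at hd
    have h := genFun_spinProjector_succ hD hn hk x u hd
    have hN : 0 < ((p + q : ℕ) : ℝ) + 2 * n - 3 := by
      have h1 : (2 : ℝ) ≤ (p + q : ℕ) := by exact_mod_cast hD
      have h2 : (1 : ℝ) ≤ n := by exact_mod_cast hn
      linarith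
    apply mul_left_cancel₀ hN.ne'
    rw [h, ih, bfGenFun, bfGenFun, sum_bfCoeff_succ hD hn]

end Recursion

end BF

theorem mainTheorem2 (p q j : ℕ) (hD : 2 ≤ p + q) (hj : 1 ≤ j)
    (k : BF.Idx p q → ℝ) (hk : BF.sq k ≠ 0) :
    ∃ Θj : Matrix (Fin j → BF.Idx p q) (Fin j → BF.Idx p q) ℝ,
      BF.symmetrizerImage j k hk = BF.toComplex Θj ∧
      BF.IsBehrendsFronsdal k Θj ∧
      BF.IsOntoSymmetricTT k Θj ∧
      (∀ T : Matrix (Fin j → BF.Idx p q) (Fin j → BF.Idx p q) ℝ,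
        BF.IsBehrendsFronsdal k T → BF.IsOntoSymmetricTT k T → T = Θj) ∧
      (∀ x u : BF.Idx p q → ℝ, BF.genFun Θj x u = BF.bfGenFun j k x u) :=
  ⟨BF.spinProjector j k, BF.symmetrizerImage_eq hj hk,
    BF.spinProjector_isBehrendsFronsdal hD hj hk, BF.spinProjector_isOntoSymmetricTT hD hj hk,
    fun _ h h' => h.eq_of_isOnto (BF.spinProjector_isBehrendsFronsdal hD hj hk) h'
      (BF.spinProjector_isOntoSymmetricTT hD hj hk),
    BF.genFun_spinProjector hD hj hk⟩
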